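/- Let $N\in\mathbb N$, $m\ge 1$, and let $\mathbb T^N=\mathbb R^N/\mathbb Z^N$ be the flat torus. Let $H_1,\dots,H_m:\mathbb T^N\times\mathbb R^N\to\mathbb R$ be continuous functions such that $p\mapsto H_i(x,p)$ is strictly convex on $\mathbb R^N$ for every $x$ and $i$, and such that for every $i$ there are functions $\alpha_i,\beta_i:[0,+\infty)\to\mathbb R$, both tending to $+\infty$ at $+\infty$, with $\alpha_i(|p|)\le H_i(x,p)\le\beta_i(|p|)$ for all $(x,p)$. Let $B(x)=(b_{ij}(x))$ be an $m\times m$ real matrix depending continuously on $x\in\mathbb T^N$ such that, for every $x$: $b_{ij}(x)\le 0$ for $j\ne i$; $\sum_{j=1}^m b_{ij}(x)=0$ for every $i$; and $B(x)$ is irreducible, i.e. for every nonempty $\mathcal I\subsetneq\{1,\dots,m\}$ there are $i\in\mathcal I$ and $j\notin\mathcal I$ with $b_{ij}(x)\ne0$. For a continuous $u:\mathbb T^N\to\mathbb R$, let $D^+u(x)$ (resp. $D^-u(x)$) be the set of the vectors $D\varphi(x)$, where $\varphi$ is of class $C^1$ near $x$ and $u-\varphi$ has a local maximum (resp. minimum)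 at $x$. For $a\in\mathbb R$, let $\mathcal H(a)$ be the set of viscosity subsolutions of the system $$H_i(x,Du_i)+\big(B(x)\mathbf u(x)\big)_i=a\quad\text{in }\mathbb T^N,\qquad i=1,\dots,m,$$ that is, of the continuous $\mathbf u=(u_1,\dots,u_m):\mathbb T^N\to\mathbb R^m$ with $H_i(x,p)+(B(x)\mathbf u(x))_i\le a$ for all $x$, all $i$ and all $p\in D^+u_i(x)$. A viscosity solution is a $\mathbf u\in\mathcal H(a)$ which also satisfies $H_i(x,p)+(B(x)\mathbf u(x))_i\ge a$ for all $x$, all $i$ and all $p\in D^-u_i(x)$. Assume the normalization that the critical value $c=\inf\{a\in\mathbb R:\mathcal H(a)\neq\varnothing\}$ equals $0$; the elements of $\mathcal H(0)$ are called critical subsolutions, and the viscosity solutions for $a=0$ critical solutions. Set $$\Phi_{i,j}(y,x)=\sup_{\mathbf v\in\mathcal H(0)}\big(v_i(x)-v_j(y)\big),$$ and let the Aubry set $\mathcal A$ be the set of the points $y\in\mathbb T^N$ such that $\Phi_{\cdot,j}(y,\cdot)=\big(\Phi_{1,j}(y,\cdot),\dots,\Phi_{m,j}(y,\cdot)\big)$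 is a critical solution, where $j\in\{1,\dots,m\}$ is any fixed index. Let $y\in\mathcal A$. Then for every $i\in\{1,\dots,m\}$ there exists a vector $p_i\in\mathbb R^N$ such that, for every critical subsolution $\mathbf u\in\mathcal H(0)$, $p_i$ is a reachable gradient of $u_i$ at $y$ (i.e. there are points $x_n\to y$ at which $u_i$ is differentiable with $Du_i(x_n)\to p_i$) and $$H_i(y,p_i)+\big(B(y)\mathbf u(y)\big)_i=0.$$ -/

import Mathlib

open Filter Topology
open scoped NNReal Matrix

namespace WeaklyCoupledHJ

/-- The momentum space `ℝ^N` with its Euclidean structure. -/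
abbrev E (N : ℕ) : Type := EuclideanSpace ℝ (Fin N)

/-- The flat torus `𝕋^N = ℝ^N / ℤ^N`. -/
abbrev Torus (N : ℕ) : Type := UnitAddTorus (Fin N)

/-- The canonical projection `ℝ^N → 𝕋^N`. -/
def proj {N : ℕ} (v : E N) : Torus N := fun k => ((v k : ℝ) : UnitAddCircle)

/-- A function on the torus read in the canonical flat chart centred at `z`: `v ↦ u (z + [v])`. -/
def localLift {N : ℕ} (u : Torus N → ℝ) (z : Torus N) : E N → ℝ := fun v => u (z + proj v)

/-- `u : 𝕋^N → ℝ` is differentiable at `z`, with gradient `p`. -/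
def HasGradAt {N : ℕ} (u : Torus N → ℝ) (p : E N) (z : Torus N) : Prop :=
  HasGradientAt (localLift u z) p 0

/-- The superdifferential `D⁺u(z)`: gradients at `z` of functions `φ` of class `C¹` near `z`
such that `u - φ` has a local maximum at `z`. -/
def superdifferential {N : ℕ} (u : Torus N → ℝ) (z : Torus N) : Set (E N) :=
  {p | ∃ φ : E N → ℝ, ContDiffAt ℝ 1 φ 0 ∧ HasGradientAt φ p 0 ∧
    IsLocalMax (fun v => localLift u z v - φ v) 0}

/-- The subdifferential `D⁻u(z)`: gradients at `z` of functions `φ` of class `C¹` near `z`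
such that `u - φ` has a local minimum at `z`. -/
def subdifferential {N : ℕ} (u : Torus N → ℝ) (z : Torus N) : Set (E N) :=
  {p | ∃ φ : E N → ℝ, ContDiffAt ℝ 1 φ 0 ∧ HasGradientAt φ p 0 ∧
    IsLocalMin (fun v => localLift u z v - φ v) 0}

/-- The set `∂*u(y)` of reachable gradients of `u` at `y`: limits of `Du(x_n)` along sequences
`x_n → y` of differentiability points of `u`. -/
def reachableGradients {N : ℕ} (u : Torus N → ℝ) (y : Torus N) : Set (E N) :=
  {p | ∃ (x : ℕ → Torus N) (q : ℕ → E N), (∀ n, HasGradAt u (q n) (x n)) ∧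
    Tendsto x atTop (𝓝 y) ∧ Tendsto q atTop (𝓝 p)}

/-- Strictly convex Hamiltonians: jointly continuous, strictly convex in the momentum, and
bounded from below and from above by coercive functions of `|p|`, uniformly in `x`. -/
structure IsStrictlyConvexHamiltonian {N : ℕ} (H : Torus N → E N → ℝ) : Prop where
  continuous : Continuous fun z : Torus N × E N => H z.1 z.2
  strictConvex : ∀ x, StrictConvexOn ℝ Set.univ (H x)
  growth : ∃ α β : ℝ≥0 → ℝ, Tendsto α atTop atTop ∧ Tendsto β atTop atTop ∧
    ∀ x p, α ‖p‖₊ ≤ H x p ∧ H x p ≤ β ‖p‖₊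

/-- Coupling matrices: non-positive off-diagonal entries and non-negative row sums. -/
def IsCouplingMatrix {m : ℕ} (B : Matrix (Fin m) (Fin m) ℝ) : Prop :=
  (∀ i j, j ≠ i → B i j ≤ 0) ∧ ∀ i, 0 ≤ ∑ j, B i j

/-- Degenerate matrices: all the row sums vanish. -/
def IsDegenerateMatrix {m : ℕ} (B : Matrix (Fin m) (Fin m) ℝ) : Prop :=
  ∀ i, ∑ j, B i j = 0

/-- Irreducible matrices: for every nonempty proper set `I` of indices there are `i ∈ I` and
`j ∉ I` with `B i j ≠ 0`. -/
def IsIrreducibleMatrix {m : ℕ} (B : Matrix (Fin m) (Fin m) ℝ) : Prop :=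
  ∀ I : Set (Fin m), I.Nonempty → I ≠ Set.univ → ∃ i ∈ I, ∃ j ∉ I, B i j ≠ 0

variable {N m : ℕ} (H : Fin m → Torus N → E N → ℝ) (B : Torus N → Matrix (Fin m) (Fin m) ℝ)

/-- Continuous viscosity subsolutions of `H_i(x, Du_i) + (B(x) u(x))_i = a_i`, `i = 1, …, m`. -/
def IsSubsolution (a : Fin m → ℝ) (u : Torus N → Fin m → ℝ) : Prop :=
  Continuous u ∧ ∀ (x : Torus N) (i : Fin m), ∀ p ∈ superdifferential (fun z => u z i) x,
    H i x p + (B x *ᵥ u x) i ≤ a i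

/-- Continuous viscosity supersolutions of `H_i(x, Du_i) + (B(x) u(x))_i = a_i`, `i = 1, …, m`. -/
def IsSupersolution (a : Fin m → ℝ) (u : Torus N → Fin m → ℝ) : Prop :=
  Continuous u ∧ ∀ (x : Torus N) (i : Fin m), ∀ p ∈ subdifferential (fun z => u z i) x,
    a i ≤ H i x p + (B x *ᵥ u x) i

/-- Continuous viscosity solutions. -/
def IsSolution (a : Fin m → ℝ) (u : Torus N → Fin m → ℝ) : Prop :=
  IsSubsolution H B a u ∧ IsSupersolution H B a u

/-- The set `ℋ(a)` of subsolutions of the system with right-hand side `(a, …, a)`. -/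
def subsolutions (a : ℝ) : Set (Torus N → Fin m → ℝ) :=
  {u | IsSubsolution H B (fun _ => a) u}

/-- `c` is the critical value: the infimum of the real numbers `a` such that `ℋ(a)` is nonempty. -/
def IsCriticalValue (c : ℝ) : Prop :=
  IsGLB {a : ℝ | (subsolutions H B a).Nonempty} c

/-- The Mañé matrix `Φ_{i,j}(y, x) = sup { v_i(x) - v_j(y) : v ∈ ℋ(0) }`. -/
noncomputable def mane (i j : Fin m) (y x : Torus N) : ℝ :=
  sSup {r | ∃ v ∈ subsolutions H B 0, r = v x i - v y j}

/-- The Aubry set, written with the index `j`: the points `y` such that `Φ_{·,j}(y, ·)` is a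
solution of the system with right-hand side `0`. -/
def aubrySet (j : Fin m) : Set (Torus N) :=
  {y | IsSolution H B (fun _ => 0) (fun x i => mane H B i j y x)}

end WeaklyCoupledHJ

namespace WeaklyCoupledHJ

open MeasureTheory

/-! ### The covering map of the torus -/

/-! Fix `i`. For each critical subsolution `u`, the admissible momenta (reachable gradients of `u_i`
at `y` giving equality in the `i`-th equation) form a closed set, bounded by coercivity. By the
finite intersection property it is enough to treat finitely many subsolutions `u_k`.

Their average is again a critical subsolution, by convexity. On the Aubry set no equation of a
critical subsolution can be strict near `y` (`not_isStrictAt`), so there are points tending to `y`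
where every `u_k` is differentiable and the average satisfies the `i`-th equation up to a vanishing
error. Along a subsequence the gradients of the `u_k` converge to vectors `p_k`, each satisfying the
inequality at `y`, while their average gives equality. This is the equality case of Jensen, so
strict convexity forces all the `p_k` to coincide and each inequality to be an equality
(`exists_common_reachable`).

Non-strictness for the reference index `j` comes from comparing `u` with the solution `Φ_{·,j}(y,
·)`, which touches `u_j - u_j(y)` from above at `y`. For the other indices, strictness of one
equation can be passed on to any equation coupled to it, and irreducibility carries it back to `j`.

Two analytic facts support this: critical subsolutions are equi-Lipschitz (`exists_lipschitz`), and
for convex Hamiltonians viscosity and almost everywhere subsolutions agree (`le_of_hasGradientAt`,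
`le_of_ae_le`). -/

lemma proj_add {N : ℕ} (v w : E N) : proj (v + w) = proj v + proj w := by
  funext k
  simp [proj]

lemma proj_zero {N : ℕ} : proj (0 : E N) = 0 := by
  funext k
  simp [proj]

lemma isOpenQuotientMap_proj {N : ℕ} : IsOpenQuotientMap (proj : E N → Torus N) := by
  have h1 : IsOpenQuotientMap (Pi.map fun (_ : Fin N) (t : ℝ) => (t : UnitAddCircle)) :=
    IsOpenQuotientMap.piMap fun _ =>
      ⟨QuotientAddGroup.mk_surjective, AddCircle.continuous_mk' 1, QuotientAddGroup.isOpenMap_coe⟩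
  have h2 := (EuclideanSpace.equiv (Fin N) ℝ).toHomeomorph.isOpenQuotientMap
  exact h1.comp h2

lemma isOpenQuotientMap_add_proj {N : ℕ} (y : Torus N) :
    IsOpenQuotientMap fun v : E N => y + proj v :=
  (Homeomorph.addLeft y).isOpenQuotientMap.comp isOpenQuotientMap_proj

lemma continuous_add_proj {N : ℕ} (y : Torus N) : Continuous fun v : E N => y + proj v :=
  (isOpenQuotientMap_add_proj y).continuous

lemma exists_eq_add_proj {N : ℕ} (y z : Torus N) : ∃ v : E N, z = y + proj v := by
  obtain ⟨v, hv⟩ := (isOpenQuotientMap_add_proj y).surjective z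
  exact ⟨v, hv.symm⟩

lemma tendsto_add_proj {N : ℕ} (y : Torus N) :
    Tendsto (fun v : E N => y + proj v) (𝓝 0) (𝓝 y) := by
  simpa [proj_zero] using (continuous_add_proj y).tendsto 0

lemma eventually_nhds_of_lift {N : ℕ} {y : Torus N} {P : Torus N → Prop}
    (h : ∀ᶠ v in 𝓝 (0 : E N), P (y + proj v)) : ∀ᶠ z in 𝓝 y, P z := by
  have h1 : 𝓝 y ≤ map (fun v : E N => y + proj v) (𝓝 0) := by
    simpa [proj_zero] using (isOpenQuotientMap_add_proj y).isOpenMap.nhds_le 0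
  exact h1 h

lemma localLift_zero {N : ℕ} (u : Torus N → ℝ) (y : Torus N) : localLift u y 0 = u y := by
  simp [localLift, proj_zero]

lemma localLift_add_proj {N : ℕ} (u : Torus N → ℝ) (y : Torus N) (v w : E N) :
    localLift u (y + proj v) w = localLift u y (v + w) := by
  simp [localLift, proj_add, add_assoc]

lemma continuous_localLift {N : ℕ} {u : Torus N → ℝ} (hu : Continuous u) (y : Torus N) :
    Continuous (localLift u y) :=
  hu.comp (continuous_add_proj y)

/-! ### Sub- and superdifferentials in a chart with an arbitrary centre -/

lemma hasGradientAt_comp_add_left {N : ℕ} {f : E N → ℝ} {v w p : E N}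
    (h : HasGradientAt f p (v + w)) : HasGradientAt (fun x => f (v + x)) p w := by
  rw [hasGradientAt_iff_hasFDerivAt] at h ⊢
  exact (hasFDerivAt_comp_add_left v).2 h

lemma hasGradAt_add_proj_iff {N : ℕ} {u : Torus N → ℝ} {y : Torus N} {v p : E N} :
    HasGradAt u p (y + proj v) ↔ HasGradientAt (localLift u y) p v := by
  have h : localLift u (y + proj v) = fun w => localLift u y (v + w) :=
    funext fun w => localLift_add_proj u y v w
  rw [HasGradAt, h, hasGradientAt_iff_hasFDerivAt, hasGradientAt_iff_hasFDerivAt,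
    hasFDerivAt_comp_add_left, add_zero]

lemma mem_superdifferential_of_lift {N : ℕ} {u : Torus N → ℝ} {y : Torus N} {v p : E N}
    {φ : E N → ℝ} (h1 : ContDiffAt ℝ 1 φ v) (h2 : HasGradientAt φ p v)
    (h3 : IsLocalMax (fun w => localLift u y w - φ w) v) :
    p ∈ superdifferential u (y + proj v) := by
  have ht : Tendsto (fun w : E N => v + w) (𝓝 0) (𝓝 v) := by
    simpa using (continuous_const_add v).tendsto (0 : E N)
  refine ⟨fun w => φ (v + w), ?_, hasGradientAt_comp_add_left (by simpa using h2), ?_⟩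
  · exact ContDiffAt.comp (0 : E N) (by simpa using h1) (contDiffAt_const.add contDiffAt_id)
  · filter_upwards [ht.eventually h3] with w hw
    simpa [localLift_add_proj] using hw

lemma mem_subdifferential_of_lift {N : ℕ} {u : Torus N → ℝ} {y : Torus N} {v p : E N}
    {φ : E N → ℝ} (h1 : ContDiffAt ℝ 1 φ v) (h2 : HasGradientAt φ p v)
    (h3 : IsLocalMin (fun w => localLift u y w - φ w) v) :
    p ∈ subdifferential u (y + proj v) := by
  have ht : Tendsto (fun w : E N => v + w) (𝓝 0) (𝓝 v) := by
    simpa using (continuous_const_add v).tendsto (0 : E N)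
  refine ⟨fun w => φ (v + w), ?_, hasGradientAt_comp_add_left (by simpa using h2), ?_⟩
  · exact ContDiffAt.comp (0 : E N) (by simpa using h1) (contDiffAt_const.add contDiffAt_id)
  · filter_upwards [ht.eventually h3] with w hw
    simpa [localLift_add_proj] using hw

lemma superdifferential_lift {N : ℕ} {u : Torus N → ℝ} {y : Torus N} {v p : E N}
    (h : p ∈ superdifferential u (y + proj v)) :
    ∃ φ : E N → ℝ, HasGradientAt φ p v ∧ IsLocalMax (fun w => localLift u y w - φ w) v := by
  obtain ⟨φ, -, h2, h3⟩ := h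
  have ht : Tendsto (fun w : E N => -v + w) (𝓝 v) (𝓝 0) := by
    simpa using (continuous_const_add (-v)).tendsto v
  refine ⟨fun w => φ (-v + w), hasGradientAt_comp_add_left (by simpa using h2), ?_⟩
  filter_upwards [ht.eventually h3] with w hw
  simpa [localLift_add_proj] using hw

lemma hasGradientAt_norm_sub_sq {N : ℕ} (v w : E N) :
    HasGradientAt (fun x : E N => ‖x - w‖ ^ 2) ((2 : ℝ) • (v - w)) v := by
  rw [hasGradientAt_iff_hasFDerivAt]
  have h := ((hasFDerivAt_id v).sub_const w).norm_sq
  refine h.congr_fderiv ?_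
  ext x
  simp [InnerProductSpace.toDual_apply_apply]

lemma hasGradientAt_inner_left {N : ℕ} (p v : E N) :
    HasGradientAt (fun x : E N => inner ℝ p x) p v := by
  rw [hasGradientAt_iff_hasFDerivAt]
  exact (InnerProductSpace.toDual ℝ (E N) p).hasFDerivAt

lemma _root_.HasGradientAt.add_real {N : ℕ} {f g : E N → ℝ} {p q v : E N}
    (hf : HasGradientAt f p v) (hg : HasGradientAt g q v) :
    HasGradientAt (fun x => f x + g x) (p + q) v := by
  rw [hasGradientAt_iff_hasFDerivAt] at *
  rw [map_add]
  exact hf.add hg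

lemma _root_.HasGradientAt.const_mul_real {N : ℕ} {f : E N → ℝ} {p v : E N} (c : ℝ)
    (hf : HasGradientAt f p v) : HasGradientAt (fun x => c * f x) (c • p) v := by
  rw [hasGradientAt_iff_hasFDerivAt] at *
  refine (hf.const_mul c).congr_fderiv ?_
  ext x
  simp [InnerProductSpace.toDual_apply_apply]

/-- Near a differentiability point there are superdifferentials close to the gradient. -/
lemma exists_superdifferential_near {N : ℕ} {u : Torus N → ℝ} (hu : Continuous u)
    {y : Torus N} {v q : E N} (h : HasGradientAt (localLift u y) q v) {ε : ℝ} (hε : 0 < ε) :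
    ∃ w p, ‖w - v‖ < ε ∧ ‖p - q‖ < ε ∧ p ∈ superdifferential u (y + proj w) := by
  have hc : (0 : ℝ) < ε / 4 := by positivity
  obtain ⟨r, hr, hball⟩ := Metric.eventually_nhds_iff.1
    ((hasGradientAt_iff_isLittleO.1 h).def hc)
  set s := min (r / 2) (ε / 2) with hs
  have hs0 : 0 < s := by positivity
  have hsr : s < r := by linarith [min_le_left (r / 2) (ε / 2)]
  have hsε : s < ε := by linarith [min_le_right (r / 2) (ε / 2)]
  -- On the sphere of radius `s` the penalty `c * s ^ 2 = ε * s / 3` beats the differentiability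
  -- error `ε * s / 4`, so the maximum is interior; the gradient shift is at most `2 * c * s = 2 * ε
  -- / 3 < ε`.
  set c := ε / (3 * s) with hcdef
  have hcs : c * s = ε / 3 := by rw [hcdef]; field_simp
  have hc0 : 0 < c := by positivity
  set φ : E N → ℝ := fun x => inner ℝ q x + c * ‖x - v‖ ^ 2 with hφ
  have hφc : ContDiff ℝ 1 φ := by
    refine ContDiff.add (contDiff_const.inner ℝ contDiff_id)
      (contDiff_const.mul ((contDiff_id.sub contDiff_const).norm_sq ℝ))
  obtain ⟨w, hw, hmax⟩ := (isCompact_closedBall v s).exists_isMaxOn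
    (Metric.nonempty_closedBall.2 hs0.le)
    ((continuous_localLift hu y).sub hφc.continuous).continuousOn
  have hmaxv := hmax (Metric.mem_closedBall_self hs0.le)
  have hwr : dist w v ≤ s := hw
  have hlt : dist w v < s := by
    refine lt_of_le_of_ne hwr fun heq => ?_
    have h1 := hball (heq.trans_lt hsr)
    rw [dist_eq_norm] at heq
    have h2 := (Real.norm_eq_abs _ ▸ le_abs_self _ |>.trans h1)
    simp only [Set.mem_ofPred_eq, hφ, Pi.sub_apply, sub_self, norm_zero, heq] at hmaxv
    rw [inner_sub_right, heq] at h2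
    have h3 : c * s ^ 2 = ε / 3 * s := by rw [← hcs]; ring
    nlinarith
  refine ⟨w, q + c • (2 : ℝ) • (w - v), ?_, ?_, ?_⟩
  · rw [← dist_eq_norm]; linarith
  · rw [add_sub_cancel_left, norm_smul, norm_smul, ← dist_eq_norm, Real.norm_of_nonneg hc0.le]
    simp only [Real.norm_ofNat]
    nlinarith
  · refine mem_superdifferential_of_lift hφc.contDiffAt ((hasGradientAt_inner_left q w).add_real
      ((hasGradientAt_norm_sub_sq w v).const_mul_real c)) ?_
    exact hmax.isLocalMax (Metric.closedBall_mem_nhds_of_mem hlt)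

/-! ### Lipschitz functions with almost everywhere constrained gradients -/

/-- A Lipschitz function whose directional derivative along `e` is almost everywhere at most `s`
near `v₀` grows with slope at most `s` in the direction `e`. -/
lemma sub_le_of_ae_gradient {N : ℕ} {U : E N → ℝ} {K : ℝ≥0} (hU : LipschitzWith K U)
    {v₀ e : E N} {s r : ℝ}
    (h : ∀ᵐ v, v ∈ Metric.ball v₀ r → inner ℝ (gradient U v) e ≤ s)
    {t : ℝ} (ht : 0 ≤ t) (htr : t * ‖e‖ < r) : U v₀ - U (v₀ - t • e) ≤ s * t := by
  set L : ℝ →ₗ[ℝ] E N := LinearMap.toSpanSingleton ℝ (E N) e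
  obtain ⟨S, hSsub, hSmeas, hS⟩ := (h.and hU.ae_differentiableAt).exists_measurable_mem
  -- Fubini: almost every line parallel to `e` meets the good set at almost every time. The line
  -- through `v₀` may be exceptional, so the estimate is proved for a dense set of base points and
  -- passed to the limit.
  have hae : ∀ᵐ v : E N, ∀ᵐ τ : ℝ, v + L τ ∈ S := by
    rw [ae_ae_add_linearMap_mem_iff L volume volume hSmeas]
    exact hSsub
  have hdense : Dense {v : E N | ∀ᵐ τ : ℝ, v + L τ ∈ S} := Measure.dense_of_ae hae
  have hclosed : IsClosed {v : E N | U v - U (v - t • e) ≤ s * t} := by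
    refine isClosed_le ?_ continuous_const
    exact hU.continuous.sub (hU.continuous.comp (continuous_id.sub continuous_const))
  have hopen : IsOpen (Metric.ball v₀ (r - t * ‖e‖)) := Metric.isOpen_ball
  have hsub : Metric.ball v₀ (r - t * ‖e‖) ∩ {v : E N | ∀ᵐ τ : ℝ, v + L τ ∈ S} ⊆
      {v : E N | U v - U (v - t • e) ≤ s * t} := by
    rintro v ⟨hv, hvS⟩
    set g : ℝ → ℝ := fun τ => U (v + L τ) with hg
    have hgL : LipschitzWith (K * ‖e‖₊) g := by
      refine LipschitzWith.of_dist_le_mul fun a b => ?_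
      refine (hU.dist_le_mul _ _).trans ?_
      rw [dist_add_left, dist_eq_norm, ← map_sub, LinearMap.toSpanSingleton_apply, norm_smul,
        ← dist_eq_norm]
      push_cast
      exact le_of_eq (by ring)
    have hac : AbsolutelyContinuousOnInterval g (-t) 0 :=
      (hgL.lipschitzOnWith).absolutelyContinuousOnInterval
    have hint := hac.integral_deriv_eq_sub
    have hle : ∫ x in (-t)..0, deriv g x ≤ ∫ _ in (-t)..0, s := by
      refine intervalIntegral.integral_mono_ae_restrict (by linarith)
        hac.intervalIntegrable_deriv intervalIntegrable_const ?_
      filter_upwards [ae_restrict_mem measurableSet_Icc, ae_restrict_of_ae hvS] with τ hτ hτS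
      obtain ⟨h1, h2⟩ := hS _ hτS
      have hmem : v + L τ ∈ Metric.ball v₀ r := by
        rw [Metric.mem_ball, dist_eq_norm] at hv ⊢
        have h3 : ‖L τ‖ ≤ t * ‖e‖ := by
          rw [LinearMap.toSpanSingleton_apply, norm_smul]
          gcongr
          rw [Real.norm_eq_abs, abs_le]
          exact ⟨hτ.1, hτ.2.trans ht⟩
        calc ‖v + L τ - v₀‖ = ‖(v - v₀) + L τ‖ := by congr 1; abel
          _ ≤ ‖v - v₀‖ + ‖L τ‖ := norm_add_le _ _
          _ < r := by linarith
      have hd : HasDerivAt g (fderiv ℝ U (v + L τ) e) τ := by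
        have hl : HasDerivAt (fun τ : ℝ => v + L τ) e τ := by
          simpa [L] using ((hasDerivAt_id τ).smul_const e).const_add v
        exact h2.hasFDerivAt.comp_hasDerivAt τ hl
      rw [hd.deriv, ← inner_gradient_left]
      exact h1 hmem
    rw [hint] at hle
    simp only [hg, intervalIntegral.integral_const, smul_eq_mul, L,
      LinearMap.toSpanSingleton_apply, neg_smul, zero_smul, add_zero, ← sub_eq_add_neg] at hle
    simp only [Set.mem_ofPred_eq]
    linarith
  have hmem := hdense.open_subset_closure_inter hopen (Metric.mem_ball_self (by linarith))
  exact closure_minimal hsub hclosed hmem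

/-- Convex constraints on the gradient that hold almost everywhere pass to the
superdifferential. -/
lemma le_of_ae_gradient {N : ℕ} {U : E N → ℝ} {K : ℝ≥0} (hU : LipschitzWith K U)
    {G : E N → E N → ℝ} (hG : Continuous fun z : E N × E N => G z.1 z.2)
    (hconv : ∀ v, ConvexOn ℝ Set.univ (G v)) {v₀ p : E N} {c r : ℝ} (hr : 0 < r)
    (h : ∀ᵐ v, v ∈ Metric.ball v₀ r → G v (gradient U v) ≤ c)
    {φ : E N → ℝ} (hφ : HasGradientAt φ p v₀) (hmax : IsLocalMax (fun v => U v - φ v) v₀) :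
    G v₀ p ≤ c := by
  by_contra! hlt
  obtain ⟨η, hη, hηp⟩ : ∃ η > 0, c + η < G v₀ p := ⟨(G v₀ p - c) / 2, by linarith, by linarith⟩
  -- Separate `p` from the closed convex sublevel set. The margin `η` absorbs the dependence of `G`
  -- on `v`, so nearby gradients lie in this set and `U` has slope at most `s` along `e`, whereas
  -- touching by `φ` forces a slope of at least `inner ℝ p e > s`.
  obtain ⟨f, s, hfs, hsp⟩ := geometric_hahn_banach_closed_point
    (s := {q | G v₀ q ≤ c + η}) (x := p) (by simpa using (hconv v₀).convex_le (c + η))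
    (isClosed_le (hG.comp (Continuous.prodMk_right v₀)) continuous_const) (by simpa using hηp)
  set e := (InnerProductSpace.toDual ℝ (E N)).symm f
  have hfe : ∀ q, f q = inner ℝ q e := fun q => by
    rw [real_inner_comm, InnerProductSpace.toDual_symm_apply]
  have hclose : ∀ᶠ v in 𝓝 v₀, ∀ q ∈ Metric.closedBall (0 : E N) K, G v₀ q < G v q + η := by
    refine (isCompact_closedBall (0 : E N) K).eventually_forall_of_forall_eventually
      fun q _ => ?_
    have h1 : Continuous fun z : E N × E N => G z.1 z.2 + η - G v₀ z.2 :=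
      (hG.add continuous_const).sub (hG.comp (continuous_const.prodMk continuous_snd))
    have h2 : ∀ᶠ z in 𝓝 (v₀, q), 0 < G z.1 z.2 + η - G v₀ z.2 :=
      h1.continuousAt.eventually (lt_mem_nhds (by simpa using hη))
    filter_upwards [h2] with z hz
    linarith
  obtain ⟨r', hr', hball⟩ := Metric.eventually_nhds_iff_ball.1 hclose
  have hslope : ∀ᵐ v, v ∈ Metric.ball v₀ (min r r') → inner ℝ (gradient U v) e ≤ s := by
    filter_upwards [h] with v hv hvr
    rw [← hfe]
    refine (hfs _ ?_).le
    have h1 := hv (Metric.ball_subset_ball (min_le_left _ _) hvr)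
    have h2 := hball v (Metric.ball_subset_ball (min_le_right _ _) hvr) (gradient U v) (by
      rw [mem_closedBall_zero_iff, gradient, LinearIsometryEquiv.norm_map]
      exact norm_fderiv_le_of_lipschitz ℝ hU)
    simp only [Set.mem_ofPred_eq]
    linarith
  have hderiv : HasDerivAt (fun t : ℝ => φ (v₀ - t • e)) (- inner ℝ p e) 0 := by
    have hl : HasDerivAt (fun t : ℝ => v₀ - t • e) (-e) 0 := by
      simpa using ((hasDerivAt_id (0 : ℝ)).smul_const e).const_sub v₀
    have h1 : HasFDerivAt φ (InnerProductSpace.toDual ℝ (E N) p) (v₀ - (0 : ℝ) • e) := by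
      simpa using hasGradientAt_iff_hasFDerivAt.1 hφ
    have h2 := h1.comp_hasDerivAt (0 : ℝ) hl
    rwa [InnerProductSpace.toDual_apply_apply, inner_neg_right] at h2
  rw [hfe] at hsp
  have hslope2 := (hasDerivAt_iff_tendsto_slope.1 hderiv).mono_left
    (nhdsWithin_mono 0 (fun x (hx : 0 < x) => hx.ne') : 𝓝[>] (0 : ℝ) ≤ 𝓝[≠] 0)
  have htend : Tendsto (fun t : ℝ => v₀ - t • e) (𝓝[>] 0) (𝓝 v₀) := by
    have : Continuous fun t : ℝ => v₀ - t • e := by fun_prop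
    simpa using (this.tendsto 0).mono_left nhdsWithin_le_nhds
  have hsmall : ∀ᶠ t : ℝ in 𝓝[>] 0, t * ‖e‖ < min r r' := by
    have h1 : Tendsto (fun t : ℝ => t * ‖e‖) (𝓝[>] 0) (𝓝 0) := by
      have : Continuous fun t : ℝ => t * ‖e‖ := by fun_prop
      simpa using (this.tendsto 0).mono_left nhdsWithin_le_nhds
    exact h1.eventually (gt_mem_nhds (lt_min hr hr'))
  obtain ⟨t, h1, h2, h3, h4⟩ := ((hslope2.eventually (gt_mem_nhds (neg_lt_neg hsp))).and
    ((htend.eventually hmax).and (hsmall.and self_mem_nhdsWithin))).exists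
  have ht : (0 : ℝ) < t := h4
  have h5 := sub_le_of_ae_gradient hU hslope ht.le h3
  simp only [slope_def_field, zero_smul, sub_zero] at h1
  rw [div_lt_iff₀ ht] at h1
  linarith

/-! ### Single equations -/

/-- A continuous function with bounded superdifferentials is Lipschitz. -/
lemma lipschitz_of_superdifferential_bounded {N : ℕ} {u : Torus N → ℝ} (hu : Continuous u)
    {K : ℝ≥0} (hK : 0 < K) (h : ∀ z, ∀ p ∈ superdifferential u z, ‖p‖ < K) (y : Torus N) :
    LipschitzWith K (localLift u y) := by
  set U := localLift u y with hUdef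
  have hUc : Continuous U := continuous_localLift hu y
  obtain ⟨M, hM⟩ := (isCompact_range hu).isBounded.exists_norm_le
  have hUM : ∀ v, |U v| ≤ M := fun v => hM _ ⟨y + proj v, rfl⟩
  have hK' : (0 : ℝ) < K := hK
  refine LipschitzWith.of_le_add_mul K fun v v₀ => ?_
  -- `K * ρ` exceeds the oscillation of `U`, so the maximum of `U - φ` is not on the sphere. Away
  -- from its vertex the cone is smooth with slope `K`, which the strict bound on superdifferentials
  -- excludes; the maximum is therefore at `v₀`.
  set ρ := (2 * M + 1) / K with hρ
  have hρK : K * ρ = 2 * M + 1 := by rw [hρ]; field_simp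
  have hM0 : 0 ≤ M := (abs_nonneg _).trans (hUM 0)
  have hρ0 : 0 < ρ := by positivity
  set φ : E N → ℝ := fun x => K * ‖x - v₀‖ with hφ
  have hφc : Continuous φ := by fun_prop
  obtain ⟨w, hw, hmax⟩ := (isCompact_closedBall v₀ ρ).exists_isMaxOn
    (Metric.nonempty_closedBall.2 hρ0.le) (hUc.sub hφc).continuousOn
  have hv₀ := hmax (Metric.mem_closedBall_self hρ0.le)
  simp only [Set.mem_ofPred_eq, Pi.sub_apply, hφ, sub_self, norm_zero, mul_zero, sub_zero] at hv₀
  have hwv : w = v₀ := by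
    by_contra hne
    have hlt : dist w v₀ < ρ := by
      rw [dist_eq_norm]
      by_contra! hge
      have h1 := mul_le_mul_of_nonneg_left hge hK'.le
      have h2 := abs_le.1 (hUM w)
      have h3 := abs_le.1 (hUM v₀)
      linarith
    have hne' : w - v₀ ≠ 0 := sub_ne_zero.2 hne
    have hcd : ContDiffAt ℝ 1 φ w :=
      contDiffAt_const.mul ((contDiffAt_norm ℝ hne').comp w (contDiffAt_id.sub contDiffAt_const))
    have hd : DifferentiableAt ℝ φ w := hcd.differentiableAt one_ne_zero
    have hp := h _ _ (mem_superdifferential_of_lift hcd hd.hasGradientAt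
      (hmax.isLocalMax (Metric.closedBall_mem_nhds_of_mem hlt)))
    have hval : inner ℝ (gradient φ w) (w - v₀) = K * ‖w - v₀‖ := by
      have hn : DifferentiableAt ℝ (fun x : E N => ‖x‖) (w - v₀) :=
        (contDiffAt_norm ℝ (n := 1) hne').differentiableAt one_ne_zero
      have h1 : HasFDerivAt φ ((K : ℝ) • fderiv ℝ (fun x : E N => ‖x‖) (w - v₀)) w :=
        (hn.hasFDerivAt.comp w ((hasFDerivAt_id w).sub_const v₀)).const_mul (K : ℝ)
      rw [inner_gradient_left, h1.fderiv]
      simp [hn.fderiv_norm_self]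
    have h3 := real_inner_le_norm (gradient φ w) (w - v₀)
    rw [hval] at h3
    have h4 : 0 < ‖w - v₀‖ := norm_pos_iff.2 hne'
    have := le_of_mul_le_mul_right h3 h4
    linarith
  by_cases hvρ : v ∈ Metric.closedBall v₀ ρ
  · have h1 := hmax hvρ
    simp only [Set.mem_ofPred_eq, Pi.sub_apply, hφ, hwv, sub_self, norm_zero, mul_zero,
      sub_zero] at h1
    rw [dist_eq_norm]
    linarith
  · rw [Metric.mem_closedBall, not_le] at hvρ
    have h1 := mul_le_mul_of_nonneg_left hvρ.le hK'.le
    have h2 := abs_le.1 (hUM v)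
    have h3 := abs_le.1 (hUM v₀)
    linarith

/-- The equation of a viscosity subsolution holds at differentiability points. -/
lemma le_of_hasGradientAt {N : ℕ} {u : Torus N → ℝ} (hu : Continuous u)
    {h : Torus N → E N → ℝ} (hh : Continuous fun z : Torus N × E N => h z.1 z.2)
    {f : Torus N → ℝ} (hf : Continuous f) {c : ℝ}
    (hsub : ∀ z, ∀ p ∈ superdifferential u z, h z p + f z ≤ c) {y : Torus N} {v q : E N}
    (hq : HasGradientAt (localLift u y) q v) :
    h (y + proj v) q + f (y + proj v) ≤ c := by
  set S : Set (E N × E N) := {a | h (y + proj a.1) a.2 + f (y + proj a.1) ≤ c}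
  have hS : IsClosed S := by
    have h1 : Continuous fun a : E N × E N => (y + proj a.1, a.2) :=
      ((continuous_add_proj y).comp continuous_fst).prodMk continuous_snd
    exact isClosed_le ((hh.comp h1).add (hf.comp (continuous_fst.comp h1))) continuous_const
  have hmem : (v, q) ∈ closure S := by
    rw [Metric.mem_closure_iff]
    intro ε hε
    obtain ⟨w, p, hw, hp, hwp⟩ := exists_superdifferential_near hu hq hε
    refine ⟨(w, p), hsub _ _ hwp, ?_⟩
    rw [dist_comm, Prod.dist_eq, dist_eq_norm, dist_eq_norm]
    exact max_lt hw hp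
  exact hS.closure_subset hmem

/-- Almost everywhere subsolutions of convex equations are viscosity subsolutions. -/
lemma le_of_ae_le {N : ℕ} {u : Torus N → ℝ} {K : ℝ≥0} {y : Torus N}
    (hu : LipschitzWith K (localLift u y))
    {h : Torus N → E N → ℝ} (hh : Continuous fun z : Torus N × E N => h z.1 z.2)
    (hconv : ∀ z, ConvexOn ℝ Set.univ (h z))
    {f : Torus N → ℝ} (hf : Continuous f) {c r : ℝ} (hr : 0 < r) {v₀ p : E N}
    (hae : ∀ᵐ v : E N, v ∈ Metric.ball v₀ r →
      h (y + proj v) (gradient (localLift u y) v) + f (y + proj v) ≤ c)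
    (hp : p ∈ superdifferential u (y + proj v₀)) :
    h (y + proj v₀) p + f (y + proj v₀) ≤ c := by
  obtain ⟨φ, hφ, hmax⟩ := superdifferential_lift hp
  have h1 : Continuous fun a : E N × E N => (y + proj a.1, a.2) :=
    ((continuous_add_proj y).comp continuous_fst).prodMk continuous_snd
  exact le_of_ae_gradient hu (G := fun v q => h (y + proj v) q + f (y + proj v))
    ((hh.comp h1).add (hf.comp (continuous_fst.comp h1)))
    (fun v => (hconv _).add_const _) hr hae hφ hmax

lemma IsStrictlyConvexHamiltonian.exists_norm_lt {N : ℕ} {H : Torus N → E N → ℝ}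
    (hH : IsStrictlyConvexHamiltonian H) (C : ℝ) :
    ∃ K : ℝ≥0, 0 < K ∧ ∀ x p, H x p ≤ C → ‖p‖ < K := by
  obtain ⟨α, β, hα, -, hbd⟩ := hH.growth
  obtain ⟨K, hK⟩ := eventually_atTop.1 (hα.eventually (eventually_gt_atTop C))
  refine ⟨K + 1, by positivity, fun x p hp => ?_⟩
  by_contra! hge
  have h1 : K ≤ ‖p‖₊ := (le_add_of_nonneg_right zero_le_one).trans (by exact_mod_cast hge)
  exact absurd ((hK _ h1).trans_le ((hbd x p).1.trans hp)) (lt_irrefl _)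

lemma IsStrictlyConvexHamiltonian.exists_forall_ge {N : ℕ} {H : Torus N → E N → ℝ}
    (hH : IsStrictlyConvexHamiltonian H) : ∃ M : ℝ, ∀ x p, -M ≤ H x p := by
  obtain ⟨K, -, hK⟩ := hH.exists_norm_lt 0
  obtain ⟨c, hc⟩ := ((isCompact_univ (X := Torus N)).prod
    (isCompact_closedBall (0 : E N) K)).bddBelow_image hH.continuous.continuousOn
  refine ⟨max (-c) 0, fun x p => ?_⟩
  rcases le_total (H x p) 0 with h0 | h0
  · have h1 := hc ⟨(x, p), ⟨Set.mem_univ _, by simpa using (hK x p h0).le⟩, rfl⟩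
    have h2 := le_max_left (-c) 0
    simp only at h1
    linarith
  · linarith [le_max_right (-c) 0]

/-! ### Coupled systems -/

/-- The standing assumptions on the system. -/
structure IsDegenerateSystem {N m : ℕ} (H : Fin m → Torus N → E N → ℝ)
    (B : Torus N → Matrix (Fin m) (Fin m) ℝ) : Prop where
  hamiltonian : ∀ i, IsStrictlyConvexHamiltonian (H i)
  continuous_entry : ∀ i j, Continuous fun x => B x i j
  coupling : ∀ x, IsCouplingMatrix (B x)
  irreducible : ∀ x, IsIrreducibleMatrix (B x)
  degenerate : ∀ x, IsDegenerateMatrix (B x)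

/-- Zero row sums kill constant vectors. Choosing `c` equal to the `i`-th component removes the
diagonal term, leaving only entries of known sign. -/
lemma IsDegenerateMatrix.mulVec_eq_sum_sub {m : ℕ} {A : Matrix (Fin m) (Fin m) ℝ}
    (hA : IsDegenerateMatrix A) (w : Fin m → ℝ) (c : ℝ) (i : Fin m) :
    (A *ᵥ w) i = ∑ k, A i k * (w k - c) := by
  simp only [mul_sub, Finset.sum_sub_distrib, ← Finset.sum_mul, hA i, zero_mul, sub_zero]
  rfl

section System

variable {N m : ℕ} {H : Fin m → Torus N → E N → ℝ} {B : Torus N → Matrix (Fin m) (Fin m) ℝ}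

lemma IsDegenerateSystem.continuous_mulVec (hS : IsDegenerateSystem H B)
    {u : Torus N → Fin m → ℝ} (hu : Continuous u) (i : Fin m) :
    Continuous fun x => (B x *ᵥ u x) i := by
  simp only [Matrix.mulVec, dotProduct]
  exact continuous_finsetSum _ fun k _ =>
    (hS.continuous_entry i k).mul ((continuous_apply k).comp hu)

lemma IsDegenerateSystem.lipschitz_of_le (hS : IsDegenerateSystem H B) (C : ℝ) :
    ∃ K : ℝ≥0, ∀ (u : Torus N → ℝ) (i : Fin m), Continuous u →
      (∀ z, ∀ p ∈ superdifferential u z, H i z p ≤ C) →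
      ∀ y, LipschitzWith K (localLift u y) := by
  choose K hK0 hK using fun i => (hS.hamiltonian i).exists_norm_lt C
  refine ⟨∑ i, K i, fun u i hu h y => ?_⟩
  exact (lipschitz_of_superdifferential_bounded hu (hK0 i) (fun z p hp => hK i z p (h z p hp))
    y).weaken (Finset.single_le_sum (f := K) (fun _ _ => zero_le) (Finset.mem_univ i))

/-- For irreducible degenerate couplings, the oscillation of a vector is controlled by the
positive part of its image. -/
lemma IsDegenerateSystem.exists_osc_le (hS : IsDegenerateSystem H B) :
    ∃ κ > 0, ∀ (x : Torus N) (w : Fin m → ℝ) (a b : Fin m), (∀ k, w b ≤ w k) → (∀ k, w k ≤ w a) →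
      κ * (w a - w b) ≤ ∑ i, max ((B x *ᵥ w) i) 0 := by
  -- Vectors normalized to have minimum `0` and maximum `1` form a compact set; `κ` comes from
  -- positivity of the right-hand side there, and the general case follows by homogeneity and
  -- invariance under constants.
  set S : Set (Fin m → ℝ) := ⋃ a, ⋃ b, Set.Icc 0 1 ∩ {w | w a = 1 ∧ w b = 0} with hSdef
  have hScompact : IsCompact S := by
    refine isCompact_iUnion fun a => isCompact_iUnion fun b => isCompact_Icc.inter_right ?_
    exact (isClosed_eq (continuous_apply a) continuous_const).inter
      (isClosed_eq (continuous_apply b) continuous_const)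
  have hcont : Continuous fun z : Torus N × (Fin m → ℝ) => ∑ i, max ((B z.1 *ᵥ z.2) i) 0 := by
    simp only [Matrix.mulVec, dotProduct]
    refine continuous_finsetSum _ fun i _ => Continuous.max ?_ continuous_const
    exact continuous_finsetSum _ fun k _ =>
      ((hS.continuous_entry i k).comp continuous_fst).mul
        ((continuous_apply k).comp continuous_snd)
  obtain ⟨κ, hκ, hκle⟩ := (isCompact_univ.prod hScompact).exists_forall_le' hcont.continuousOn
    (a := 0) (by
      rintro ⟨x, w⟩ ⟨-, hw⟩
      simp only [hSdef, Set.mem_iUnion] at hw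
      obtain ⟨a, b, ⟨hw0, hw1⟩, hwa, hwb⟩ := hw
      -- Irreducibility applied to the set of maximal components yields a maximal `i` coupled to a
      -- non-maximal `k`, which makes `(B x *ᵥ w) i` positive.
      obtain ⟨i, hi, k, hk, hik⟩ := hS.irreducible x {i | w i = 1} ⟨a, hwa⟩ (fun h => by
        have h1 : b ∈ {i | w i = 1} := h ▸ Set.mem_univ b
        simp only [Set.mem_ofPred_eq] at h1
        linarith)
      simp only [Set.mem_ofPred_eq] at hi hk
      have hki : k ≠ i := fun h => hk (h ▸ hi)
      have hterm : ∀ l, 0 ≤ B x i l * (w l - 1) := fun l => by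
        rcases eq_or_ne l i with rfl | hl
        · simp [hi]
        · exact mul_nonneg_of_nonpos_of_nonpos ((hS.coupling x).1 i l hl)
            (sub_nonpos.2 (hw1 l))
      have hpos : 0 < (B x *ᵥ w) i := by
        rw [(hS.degenerate x).mulVec_eq_sum_sub w 1 i]
        refine Finset.sum_pos' (fun l _ => hterm l) ⟨k, Finset.mem_univ k, ?_⟩
        refine lt_of_le_of_ne (hterm k) (Ne.symm (mul_ne_zero hik (sub_ne_zero.2 hk)))
      refine Finset.sum_pos' (fun l _ => le_max_right _ _) ⟨i, Finset.mem_univ i, ?_⟩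
      exact lt_max_of_lt_left hpos)
  refine ⟨κ, hκ, fun x w a b hb ha => ?_⟩
  rcases (sub_nonneg.2 (hb a)).eq_or_lt with h0 | hD
  · rw [← h0, mul_zero]
    exact Finset.sum_nonneg fun l _ => le_max_right _ _
  set D := w a - w b
  have h1 := hκle (x, fun k => (w k - w b) / D) ⟨Set.mem_univ _, by
    simp only [hSdef, Set.mem_iUnion]
    refine ⟨a, b, ⟨fun k => ?_, fun k => ?_⟩, div_self hD.ne', by simp⟩
    · exact div_nonneg (sub_nonneg.2 (hb k)) hD.le
    · exact (div_le_one hD).2 (sub_le_sub_right (ha k) _)⟩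
  have h2 : ∀ i, (B x *ᵥ fun k => (w k - w b) / D) i = (B x *ᵥ w) i / D := fun i => by
    rw [(hS.degenerate x).mulVec_eq_sum_sub w (w b) i, Finset.sum_div]
    simp only [Matrix.mulVec, dotProduct, mul_div_assoc]
  simp only [h2] at h1
  calc κ * D ≤ (∑ i, max ((B x *ᵥ w) i / D) 0) * D := by gcongr
    _ = ∑ i, max ((B x *ᵥ w) i) 0 := by
      rw [Finset.sum_mul]
      refine Finset.sum_congr rfl fun i _ => ?_
      rw [max_mul_of_nonneg _ _ hD.le, div_mul_cancel₀ _ hD.ne', zero_mul]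

/-- The constant here depends on `u`, through a lower bound of the coupling term. It serves to
provide almost everywhere differentiability, from which the uniform bounds are derived. -/
lemma IsDegenerateSystem.exists_lipschitz_single (hS : IsDegenerateSystem H B)
    {u : Torus N → Fin m → ℝ} (hu : u ∈ subsolutions H B 0) :
    ∃ K : ℝ≥0, ∀ i y, LipschitzWith K (localLift (fun x => u x i) y) := by
  have hbd : ∀ i, ∃ C, ∀ x, -C ≤ (B x *ᵥ u x) i := fun i => by
    obtain ⟨c, hc⟩ := (isCompact_range (hS.continuous_mulVec hu.1 i)).bddBelow
    exact ⟨-c, fun x => by simpa using hc ⟨x, rfl⟩⟩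
  choose C hC using hbd
  obtain ⟨K, hK⟩ := hS.lipschitz_of_le (∑ i, |C i|)
  refine ⟨K, fun i y => hK _ i ((continuous_apply i).comp hu.1) (fun z p hp => ?_) y⟩
  have h1 := hu.2 z i p hp
  have h2 := hC i z
  have h3 := Finset.single_le_sum (f := fun i => |C i|) (fun _ _ => abs_nonneg _)
    (Finset.mem_univ i)
  have h4 := le_abs_self (C i)
  simp only at h1 h3
  linarith

lemma IsDegenerateSystem.le_of_hasGradientAt (hS : IsDegenerateSystem H B)
    {u : Torus N → Fin m → ℝ} (hu : u ∈ subsolutions H B 0) {i : Fin m} {y : Torus N}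
    {v q : E N} (hq : HasGradientAt (localLift (fun x => u x i) y) q v) :
    H i (y + proj v) q + (B (y + proj v) *ᵥ u (y + proj v)) i ≤ 0 :=
  WeaklyCoupledHJ.le_of_hasGradientAt ((continuous_apply i).comp hu.1)
    (hS.hamiltonian i).continuous (hS.continuous_mulVec hu.1 i) (fun z p hp => hu.2 z i p hp) hq

/-- The components of critical subsolutions differ by a uniformly bounded amount. -/
lemma IsDegenerateSystem.exists_component_sub_le (hS : IsDegenerateSystem H B) :
    ∃ C, ∀ u ∈ subsolutions H B 0, ∀ x a b, u x a - u x b ≤ C := by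
  choose M hM using fun i => (hS.hamiltonian i).exists_forall_ge
  obtain ⟨κ, hκ, hosc⟩ := hS.exists_osc_le
  refine ⟨(∑ i, max (M i) 0) / κ, fun u hu x a b => ?_⟩
  obtain ⟨K, hK⟩ := hS.exists_lipschitz_single hu
  -- At differentiability points the equation bounds the coupling term by `-H i`; these points are
  -- dense and the term is continuous.
  have hle : ∀ i, (B x *ᵥ u x) i ≤ M i := fun i => by
    have hd : Dense {v : E N | DifferentiableAt ℝ (localLift (fun z => u z i) x) v} :=
      Measure.dense_of_ae (μ := volume) (hK i x).ae_differentiableAt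
    have hcl : IsClosed {v : E N | (B (x + proj v) *ᵥ u (x + proj v)) i ≤ M i} :=
      isClosed_le ((hS.continuous_mulVec hu.1 i).comp (continuous_add_proj x)) continuous_const
    have hsub : {v : E N | DifferentiableAt ℝ (localLift (fun z => u z i) x) v} ⊆
        {v : E N | (B (x + proj v) *ᵥ u (x + proj v)) i ≤ M i} := fun v hv => by
      have h1 := hS.le_of_hasGradientAt hu (DifferentiableAt.hasGradientAt hv)
      have h2 := hM i (x + proj v) (gradient (localLift (fun z => u z i) x) v)
      simp only [Set.mem_ofPred_eq]
      linarith
    have h3 := closure_minimal hsub hcl (hd 0)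
    simpa [proj_zero] using h3
  have hne : (Finset.univ : Finset (Fin m)).Nonempty := ⟨a, Finset.mem_univ a⟩
  obtain ⟨a', -, ha'⟩ := Finset.exists_max_image Finset.univ (u x) hne
  obtain ⟨b', -, hb'⟩ := Finset.exists_min_image Finset.univ (u x) hne
  rw [le_div_iff₀' hκ]
  have h1 := ha' a (Finset.mem_univ a)
  have h2 := hb' b (Finset.mem_univ b)
  calc κ * (u x a - u x b) ≤ κ * (u x a' - u x b') := by gcongr
    _ ≤ ∑ i, max ((B x *ᵥ u x) i) 0 := hosc x (u x) a' b' (fun k => hb' k (Finset.mem_univ k))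
      (fun k => ha' k (Finset.mem_univ k))
    _ ≤ ∑ i, max (M i) 0 := Finset.sum_le_sum fun i _ => max_le_max_right 0 (hle i)

/-- Critical subsolutions are equi-Lipschitz. -/
lemma IsDegenerateSystem.exists_lipschitz (hS : IsDegenerateSystem H B) :
    ∃ K : ℝ≥0, ∀ u ∈ subsolutions H B 0, ∀ i y,
      LipschitzWith K (localLift (fun x => u x i) y) := by
  obtain ⟨C, hC⟩ := hS.exists_component_sub_le
  have hb : ∀ i k, ∃ b, ∀ x, |B x i k| ≤ b := fun i k => by
    obtain ⟨b, hb⟩ := (isCompact_range (hS.continuous_entry i k)).isBounded.exists_norm_le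
    exact ⟨b, fun x => hb _ ⟨x, rfl⟩⟩
  choose b hb using hb
  obtain ⟨K, hK⟩ := hS.lipschitz_of_le (∑ i, ∑ k, b i k * C)
  refine ⟨K, fun u hu i y => hK _ i ((continuous_apply i).comp hu.1) (fun z p hp => ?_) y⟩
  have hC0 : 0 ≤ C := by simpa using hC u hu z i i
  have h1 := hu.2 z i p hp
  have h2 : -(B z *ᵥ u z) i ≤ ∑ k, b i k * C := by
    rw [(hS.degenerate z).mulVec_eq_sum_sub (u z) (u z i) i, ← Finset.sum_neg_distrib]
    refine Finset.sum_le_sum fun k _ => ?_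
    calc -(B z i k * (u z k - u z i)) ≤ |B z i k * (u z k - u z i)| := neg_le_abs _
      _ = |B z i k| * |u z k - u z i| := abs_mul _ _
      _ ≤ b i k * C := by
        refine mul_le_mul (hb i k z) (abs_le.2 ⟨?_, hC u hu z k i⟩) (abs_nonneg _)
          ((abs_nonneg _).trans (hb i k z))
        linarith [hC u hu z i k]
  have h3 := Finset.single_le_sum (f := fun i => ∑ k, b i k * C) (fun l _ =>
    Finset.sum_nonneg fun k _ => mul_nonneg ((abs_nonneg _).trans (hb l k z)) hC0)
    (Finset.mem_univ i)
  simp only at h1 h3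
  linarith

/-- The content is that the supremum is finite: the uniform Lipschitz bound moves `x` to `y`, and
the uniform gap between components compares `i` with `j` at `y`. -/
lemma IsDegenerateSystem.le_mane (hS : IsDegenerateSystem H B) {u : Torus N → Fin m → ℝ}
    (hu : u ∈ subsolutions H B 0) (i j : Fin m) (y x : Torus N) :
    u x i - u y j ≤ mane H B i j y x := by
  refine le_csSup ?_ ⟨u, hu, rfl⟩
  obtain ⟨C, hC⟩ := hS.exists_component_sub_le
  obtain ⟨K, hK⟩ := hS.exists_lipschitz
  obtain ⟨v, rfl⟩ := exists_eq_add_proj y x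
  refine ⟨K * dist v 0 + C, ?_⟩
  rintro _ ⟨w, hw, rfl⟩
  have h1 := (hK w hw i y).le_add_mul v 0
  rw [localLift_zero] at h1
  have h2 := hC w hw y i j
  simp only [localLift] at h1
  linarith

lemma mane_self {j : Fin m} {y : Torus N} (hne : (subsolutions H B 0).Nonempty) :
    mane H B j j y y = 0 := by
  obtain ⟨u, hu⟩ := hne
  have : {r | ∃ v ∈ subsolutions H B 0, r = v y j - v y j} = {0} := by
    ext r
    simp only [sub_self, Set.mem_ofPred_eq, Set.mem_singleton_iff]
    exact ⟨fun ⟨_, _, h⟩ => h, fun h => ⟨u, hu, h⟩⟩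
  rw [mane, this, csSup_singleton]

/-! ### Convex combinations of subsolutions -/

lemma hasGradientAt_sum_mul {ι : Type*} (s : Finset ι) (w : ι → ℝ) {U : ι → E N → ℝ}
    {q : ι → E N} {v : E N} (h : ∀ k ∈ s, HasGradientAt (U k) (q k) v) :
    HasGradientAt (fun x => ∑ k ∈ s, w k * U k x) (∑ k ∈ s, w k • q k) v := by
  rw [hasGradientAt_iff_hasFDerivAt, map_sum]
  refine HasFDerivAt.fun_sum fun k hk => ?_
  exact hasGradientAt_iff_hasFDerivAt.1 ((h k hk).const_mul_real (w k))

lemma mulVec_sum_mul {ι : Type*} (s : Finset ι) (w : ι → ℝ) (f : ι → Fin m → ℝ)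
    (A : Matrix (Fin m) (Fin m) ℝ) (i : Fin m) :
    (A *ᵥ fun l => ∑ k ∈ s, w k * f k l) i = ∑ k ∈ s, w k * (A *ᵥ f k) i := by
  simp only [Matrix.mulVec, dotProduct, Finset.mul_sum]
  rw [Finset.sum_comm]
  exact Finset.sum_congr rfl fun k _ => Finset.sum_congr rfl fun l _ => by ring

/-- A superdifferential of a sum need not split into superdifferentials of the summands, so Jensen
is applied at common differentiability points and `le_of_ae_le` returns to the viscosity sense. -/
lemma IsDegenerateSystem.sum_mul_mem_subsolutions (hS : IsDegenerateSystem H B) {ι : Type*}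
    (s : Finset ι) {w : ι → ℝ} (hw0 : ∀ k ∈ s, 0 ≤ w k) (hw1 : ∑ k ∈ s, w k = 1)
    {u : ι → Torus N → Fin m → ℝ} (hu : ∀ k ∈ s, u k ∈ subsolutions H B 0) :
    (fun x l => ∑ k ∈ s, w k * u k x l) ∈ subsolutions H B 0 := by
  have hcont : Continuous fun (x : Torus N) (l : Fin m) => ∑ k ∈ s, w k * u k x l :=
    continuous_pi fun l => continuous_finsetSum _ fun k hk =>
      continuous_const.mul ((continuous_apply l).comp (hu k hk).1)
  refine ⟨hcont, fun z i p hp => ?_⟩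
  obtain ⟨K, hK⟩ := hS.exists_lipschitz
  have hLip : LipschitzWith K (localLift (fun x => ∑ k ∈ s, w k * u k x i) z) := by
    refine LipschitzWith.of_le_add_mul K fun a b => ?_
    calc ∑ k ∈ s, w k * localLift (fun x => u k x i) z a
        ≤ ∑ k ∈ s, w k * (localLift (fun x => u k x i) z b + K * dist a b) :=
          Finset.sum_le_sum fun k hk => mul_le_mul_of_nonneg_left
            ((hK _ (hu k hk) i z).le_add_mul a b) (hw0 k hk)
      _ = ∑ k ∈ s, w k * localLift (fun x => u k x i) z b + K * dist a b := by
          simp only [mul_add, Finset.sum_add_distrib, ← Finset.sum_mul, hw1, one_mul]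
  have hae : ∀ᵐ v : E N, ∀ k ∈ s,
      DifferentiableAt ℝ (localLift (fun x => u k x i) z) v := by
    rw [Filter.eventually_all_finset]
    exact fun k hk => (hK _ (hu k hk) i z).ae_differentiableAt
  have h0 := le_of_ae_le (v₀ := 0) (p := p) (c := 0) hLip (hS.hamiltonian i).continuous
    (fun z => ((hS.hamiltonian i).strictConvex z).convexOn)
    (hS.continuous_mulVec hcont i) one_pos (by
      filter_upwards [hae] with v hv _
      have hg := hasGradientAt_sum_mul s w fun k hk => (hv k hk).hasGradientAt
      rw [HasGradientAt.gradient (f := localLift (fun x => ∑ k ∈ s, w k * u k x i) z) hg,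
        mulVec_sum_mul]
      have hconv := ((hS.hamiltonian i).strictConvex (z + proj v)).convexOn.map_sum_le hw0 hw1
        (p := fun k => gradient (localLift (fun x => u k x i) z) v) (fun _ _ => Set.mem_univ _)
      have hsum : ∑ k ∈ s, w k * (H i (z + proj v) (gradient (localLift (fun x => u k x i) z) v)
          + (B (z + proj v) *ᵥ u k (z + proj v)) i) ≤ 0 :=
        Finset.sum_nonpos fun k hk => mul_nonpos_of_nonneg_of_nonpos (hw0 k hk)
          (hS.le_of_hasGradientAt (hu k hk) (hv k hk).hasGradientAt)
      simp only [mul_add, Finset.sum_add_distrib] at hsum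
      simp only [smul_eq_mul] at hconv
      linarith)
    (by simpa [proj_zero] using hp)
  simpa [proj_zero] using h0

/-! ### Strict subsolutions and the Aubry set -/

/-- The `i`-th equation is strictly satisfied by the subsolution `u` near `y`. -/
def IsStrictAt (H : Fin m → Torus N → E N → ℝ) (B : Torus N → Matrix (Fin m) (Fin m) ℝ)
    (u : Torus N → Fin m → ℝ) (i : Fin m) (y : Torus N) : Prop :=
  ∃ δ > 0, ∀ᶠ z in 𝓝 y, ∀ p ∈ superdifferential (fun x => u x i) z,
    H i z p + (B z *ᵥ u z) i ≤ -δ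

/-- Doubling of variables: if `W - V` has a minimum at `y`, then there are almost equal elements
of the superdifferential of `V` and of the subdifferential of `W` near `y`. -/
lemma exists_close_semidifferentials {V W : Torus N → ℝ} {y : Torus N} {K : ℝ≥0}
    (hV : LipschitzWith K (localLift V y)) (hW : Continuous W)
    (hle : ∀ z, V z - W z ≤ V y - W y) {ε : ℝ} (hε : 0 < ε) (hε1 : ε ≤ 1) :
    ∃ v w p q : E N, ‖v‖ < ε ∧ ‖w‖ < ε ∧ ‖p - q‖ < ε ∧ ‖q‖ ≤ 2 * K ∧
      p ∈ superdifferential V (y + proj v) ∧ q ∈ subdifferential W (y + proj w) := by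
  -- The maximality inequality `‖v‖ ^ 2 + n * d ^ 2 ≤ K * d` gives `n * d ≤ K`, hence the bound on
  -- `q`; this size of `n` then makes `d` and `‖v‖` smaller than `ε / 2`.
  set n : ℝ := 4 * (K + 1) ^ 2 / ε ^ 2 with hn
  have hK : (0 : ℝ) ≤ K := K.2
  have hn0 : 0 < n := by positivity
  have hnε : n * ε ^ 2 = 4 * (K + 1) ^ 2 := by rw [hn]; field_simp
  set V' := localLift V y
  set W' := localLift W y
  have hW' : Continuous W' := continuous_localLift hW y
  -- The extremum at `y` need not be strict; the term `‖a.1‖ ^ 2` localizes it and accounts for the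
  -- difference `p - q = 2 • v`.
  set Ψ : E N × E N → ℝ := fun a => V' a.1 - W' a.2 - ‖a.1‖ ^ 2 - n * ‖a.1 - a.2‖ ^ 2 with hΨ
  have hΨc : Continuous Ψ := by
    have := hV.continuous
    fun_prop
  obtain ⟨⟨v, w⟩, ⟨hv, hw⟩, hmax⟩ := ((isCompact_closedBall (0 : E N) 1).prod
    (isCompact_closedBall (0 : E N) 1)).exists_isMaxOn
    ⟨(0, 0), by simp⟩ hΨc.continuousOn
  have h00 := hmax (show ((0 : E N), (0 : E N)) ∈ _ by simp)
  simp only [Set.mem_ofPred_eq, hΨ, norm_zero, sub_self] at h00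
  set d := ‖v - w‖ with hd
  have hd0 : 0 ≤ d := norm_nonneg _
  have hlip : V' v - V' w ≤ K * d := by
    have := hV.le_add_mul v w
    rw [dist_eq_norm] at this
    linarith
  have hlew : V' w - W' w ≤ V' 0 - W' 0 := by
    simp only [V', W', localLift_zero]
    exact hle (y + proj w)
  have hmain : ‖v‖ ^ 2 + n * d ^ 2 ≤ K * d := by
    simp only [ne_eq, OfNat.ofNat_ne_zero, not_false_eq_true, zero_pow, mul_zero, sub_zero] at h00
    linarith
  have hnd : n * d ≤ K := by
    rcases hd0.eq_or_lt with h | h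
    · rw [← h, mul_zero]; exact hK
    · nlinarith [sq_nonneg ‖v‖]
  have hdε : d < ε / 2 := by
    by_contra! hge
    have h1 : n * ε ^ 2 ≤ n * (2 * d * ε) := by
      refine mul_le_mul_of_nonneg_left ?_ hn0.le
      nlinarith
    nlinarith
  have hvε : ‖v‖ < ε / 2 := by
    by_contra! hge
    have h1 : (ε / 2) ^ 2 ≤ ‖v‖ ^ 2 := by gcongr
    have h2 : (ε / 2) ^ 2 ≤ K * d := by nlinarith [mul_nonneg hn0.le (sq_nonneg d)]
    have h3 : n * (ε / 2) ^ 2 ≤ n * (K * d) := mul_le_mul_of_nonneg_left h2 hn0.le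
    nlinarith
  have hwε : ‖w‖ < ε := by
    have h1 := norm_sub_norm_le w v
    rw [norm_sub_rev] at h1
    linarith
  have hv1 : Metric.closedBall (0 : E N) 1 ∈ 𝓝 v :=
    Metric.closedBall_mem_nhds_of_mem (by rw [mem_ball_zero_iff]; linarith)
  have hw1 : Metric.closedBall (0 : E N) 1 ∈ 𝓝 w :=
    Metric.closedBall_mem_nhds_of_mem (by rw [mem_ball_zero_iff]; linarith)
  refine ⟨v, w, (2 : ℝ) • (v - 0) + n • (2 : ℝ) • (v - w), (-n) • (2 : ℝ) • (w - v),
    by linarith, hwε, ?_, ?_, ?_, ?_⟩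
  · have : (2 : ℝ) • (v - 0) + n • (2 : ℝ) • (v - w) - (-n) • (2 : ℝ) • (w - v) = (2 : ℝ) • v := by
      module
    rw [this, norm_smul, Real.norm_ofNat]
    linarith
  · rw [norm_smul, norm_smul, norm_sub_rev, ← hd, norm_neg, Real.norm_ofNat,
      Real.norm_of_nonneg hn0.le]
    linarith
  · refine mem_superdifferential_of_lift (φ := fun x => ‖x - 0‖ ^ 2 + n * ‖x - w‖ ^ 2) ?_
      ((hasGradientAt_norm_sub_sq v 0).add_real
        ((hasGradientAt_norm_sub_sq v w).const_mul_real n)) ?_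
    · exact (((contDiff_id.sub contDiff_const).norm_sq ℝ).add (contDiff_const.mul
        ((contDiff_id.sub contDiff_const).norm_sq ℝ))).contDiffAt
    · filter_upwards [hv1] with x hx
      have h1 := hmax (show (x, w) ∈ _ from ⟨hx, hw⟩)
      simp only [Set.mem_ofPred_eq, hΨ] at h1
      simp only [sub_zero]
      linarith
  · refine mem_subdifferential_of_lift (φ := fun x => -n * ‖x - v‖ ^ 2) ?_
      ((hasGradientAt_norm_sub_sq w v).const_mul_real (-n)) ?_
    · exact (contDiff_const.mul ((contDiff_id.sub contDiff_const).norm_sq ℝ)).contDiffAt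
    · filter_upwards [hw1] with x hx
      have h1 := hmax (show (v, x) ∈ _ from ⟨hv, hx⟩)
      simp only [Set.mem_ofPred_eq, hΨ] at h1
      rw [norm_sub_rev x v, norm_sub_rev w v]
      linarith

/-- Since `u_j - Φ_{j,j}(y, ·)` is maximal at `y`, doubling variables yields one limit momentum for
both functions. The strict inequality for `u` contradicts the supersolution inequality for `Φ`,
because `Φ_{k,j}(y, y) ≥ u_k(y) - u_j(y)` and the off-diagonal entries are non-positive. -/
lemma IsDegenerateSystem.not_isStrictAt_base (hS : IsDegenerateSystem H B) {j : Fin m}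
    {y : Torus N} (hy : y ∈ aubrySet H B j) {u : Torus N → Fin m → ℝ}
    (hu : u ∈ subsolutions H B 0) : ¬ IsStrictAt H B u j y := by
  rintro ⟨δ, hδ, hstrict⟩
  obtain ⟨hsub, hsup⟩ := hy
  set Φ : Torus N → Fin m → ℝ := fun x i => mane H B i j y x with hΦ
  have hΦj : Φ y j = 0 := mane_self ⟨u, hu⟩
  obtain ⟨K, hK⟩ := hS.exists_lipschitz
  have hle : ∀ z, u z j - Φ z j ≤ u y j - Φ y j := fun z => by
    have := hS.le_mane hu j j y z
    simp only [hΦj]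
    simp only [hΦ]
    linarith
  have hex : ∀ n : ℕ, ∃ v w p q : E N, ‖v‖ < 1 / ((n : ℝ) + 1) ∧ ‖w‖ < 1 / ((n : ℝ) + 1) ∧
      ‖p - q‖ < 1 / ((n : ℝ) + 1) ∧ ‖q‖ ≤ 2 * K ∧
      p ∈ superdifferential (fun x => u x j) (y + proj v) ∧
      q ∈ subdifferential (fun x => Φ x j) (y + proj w) := fun n =>
    exists_close_semidifferentials (hK u hu j y) ((continuous_apply j).comp hsup.1) hle
      (by positivity) (by
        rw [div_le_one (by positivity)]
        linarith [(Nat.cast_nonneg n : (0 : ℝ) ≤ n)])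
  choose v w p q hv hw hpq hq hp hq' using hex
  have hlim := tendsto_one_div_add_atTop_nhds_zero_nat (𝕜 := ℝ)
  have hv0 : Tendsto v atTop (𝓝 0) := squeeze_zero_norm (fun n => (hv n).le) hlim
  have hw0 : Tendsto w atTop (𝓝 0) := squeeze_zero_norm (fun n => (hw n).le) hlim
  have hpq0 : Tendsto (fun n => p n - q n) atTop (𝓝 0) :=
    squeeze_zero_norm (fun n => (hpq n).le) hlim
  obtain ⟨qb, -, σ, hσ, hqb⟩ := (isCompact_closedBall (0 : E N) (2 * K)).tendsto_subseq
    (fun n => by simpa using hq n : ∀ n, q n ∈ _)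
  have hpb : Tendsto (p ∘ σ) atTop (𝓝 qb) := by
    have := (hpq0.comp hσ.tendsto_atTop).add hqb
    simpa [Function.comp_def] using this
  have hzv := (tendsto_add_proj y).comp (hv0.comp hσ.tendsto_atTop)
  have hzw := (tendsto_add_proj y).comp (hw0.comp hσ.tendsto_atTop)
  have hHc := (hS.hamiltonian j).continuous
  have h1 : H j y qb + (B y *ᵥ u y) j ≤ -δ := by
    refine le_of_tendsto (((hHc.tendsto (y, qb)).comp (hzv.prodMk_nhds hpb)).add
      (((hS.continuous_mulVec hu.1 j).tendsto y).comp hzv)) ?_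
    filter_upwards [hzv.eventually hstrict] with n hn
    exact hn _ (hp _)
  have h2 : 0 ≤ H j y qb + (B y *ᵥ Φ y) j := by
    refine ge_of_tendsto (((hHc.tendsto (y, qb)).comp (hzw.prodMk_nhds hqb)).add
      (((hS.continuous_mulVec hsup.1 j).tendsto y).comp hzw)) (Eventually.of_forall fun n => ?_)
    exact hsup.2 _ _ _ (hq' _)
  have h3 : (B y *ᵥ Φ y) j ≤ (B y *ᵥ u y) j := by
    rw [(hS.degenerate y).mulVec_eq_sum_sub (u y) (u y j) j,
      (hS.degenerate y).mulVec_eq_sum_sub (Φ y) 0 j]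
    simp only [sub_zero]
    refine Finset.sum_le_sum fun k _ => ?_
    rcases eq_or_ne k j with rfl | hk
    · simp [hΦj]
    · exact mul_le_mul_of_nonpos_left (hS.le_mane hu k j y y) ((hS.coupling y).1 j k hk)
  linarith

/-- The sum of `1 - cos (2π (x_k - y_k))` is smooth and periodic and vanishes only at `y`; by
compactness it is at least some `η > 0` off `O`, and a smooth cutoff at level `η` does the rest. -/
lemma exists_bump {y : Torus N} {O : Set (Torus N)} (hO : O ∈ 𝓝 y) :
    ∃ φ : Torus N → ℝ, Continuous φ ∧ (∀ z, 0 ≤ φ z) ∧ (∀ z, φ z ≤ 1) ∧ 0 < φ y ∧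
      (∀ z ∉ O, φ z = 0) ∧ ContDiff ℝ 1 (localLift φ y) := by
  set g : Torus N → ℝ := fun x => ∑ k, (1 - (AddCircle.toCircle (x k - y k) : ℂ).re) with hg
  have hgc : Continuous g := by
    refine continuous_finsetSum _ fun k _ => continuous_const.sub ?_
    exact Complex.continuous_re.comp (continuous_subtype_val.comp
      (AddCircle.continuous_toCircle.comp ((continuous_apply k).sub continuous_const)))
  have hterm : ∀ c : Circle, 0 ≤ 1 - (c : ℂ).re := fun c => by
    have := Complex.re_le_norm (c : ℂ)
    rw [Circle.norm_coe] at this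
    linarith
  have hpos : ∀ x ∈ (interior O)ᶜ, 0 < g x := fun x hx => by
    refine (Finset.sum_nonneg fun k _ => hterm _).lt_of_ne fun h => hx ?_
    have hxy : x = y := by
      funext k
      have h1 := (Finset.sum_eq_zero_iff_of_nonneg fun k _ => hterm _).1 h.symm k
        (Finset.mem_univ k)
      have h2 : (AddCircle.toCircle (x k - y k) : ℂ).re = 1 := by linarith
      have h3 : AddCircle.toCircle (x k - y k) = 1 := by
        apply Circle.ext
        have h4 : ‖(AddCircle.toCircle (x k - y k) : ℂ)‖ ^ 2 = 1 := by
          rw [Circle.norm_coe, one_pow]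
        rw [Complex.sq_norm, Complex.normSq_apply, h2] at h4
        refine Complex.ext (by simpa using h2) ?_
        have h5 : (AddCircle.toCircle (x k - y k) : ℂ).im ^ 2 = 0 := by nlinarith
        simpa using h5
      rw [← AddCircle.toCircle_zero] at h3
      exact sub_eq_zero.1 (AddCircle.injective_toCircle one_ne_zero h3)
    rw [hxy]
    exact mem_interior_iff_mem_nhds.2 hO
  obtain ⟨η, hη, hηle⟩ := isOpen_interior.isClosed_compl.isCompact.exists_forall_le'
    hgc.continuousOn hpos
  refine ⟨fun x => Real.smoothTransition (η - g x), ?_, fun _ => Real.smoothTransition.nonneg _,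
    fun _ => Real.smoothTransition.le_one _, ?_, fun z hz => ?_, ?_⟩
  · exact Real.smoothTransition.continuous.comp (continuous_const.sub hgc)
  · refine Real.smoothTransition.pos_of_pos ?_
    simpa [hg] using hη
  · refine Real.smoothTransition.zero_of_nonpos ?_
    linarith [hηle z fun h => hz (interior_subset h)]
  · have h1 : localLift (fun x => Real.smoothTransition (η - g x)) y =
        fun v : E N => Real.smoothTransition (η - ∑ k, (1 - Real.cos (2 * Real.pi * v k))) := by
      funext v
      simp only [localLift, hg, Pi.add_apply, add_sub_cancel_left, proj,
        AddCircle.toCircle_apply_mk, div_one, Circle.coe_exp, Complex.exp_ofReal_mul_I_re]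
    rw [h1]
    refine Real.smoothTransition.contDiff.comp (contDiff_const.sub (ContDiff.sum fun k _ =>
      contDiff_const.sub (Real.contDiff_cos.comp (contDiff_const.mul ?_))))
    exact (EuclideanSpace.proj (𝕜 := ℝ) k).contDiff

lemma sub_gradient_mem_superdifferential {u ψ : Torus N → ℝ} {z : Torus N} {p : E N}
    (hψ : ContDiffAt ℝ 1 (localLift ψ z) 0)
    (hp : p ∈ superdifferential (fun x => u x + ψ x) z) :
    p - gradient (localLift ψ z) 0 ∈ superdifferential u z := by
  obtain ⟨φ, h1, h2, h3⟩ := hp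
  refine ⟨fun v => φ v + (-1) * localLift ψ z v, h1.add (contDiffAt_const.mul hψ), ?_, ?_⟩
  · have h4 := h2.add_real ((hψ.differentiableAt one_ne_zero).hasGradientAt.const_mul_real (-1))
    simpa [sub_eq_add_neg] using h4
  · filter_upwards [h3] with v hv
    simp only [localLift] at hv ⊢
    linarith

lemma mulVec_add_single (A : Matrix (Fin m) (Fin m) ℝ) (f : Fin m → ℝ) (l i : Fin m) (t : ℝ) :
    (A *ᵥ (f + Pi.single l t)) i = (A *ᵥ f) i + A i l * t := by
  simp [Matrix.mulVec_add, Matrix.mulVec_single, mul_comm]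

/-- Strictness propagates along the nonzero entries of the coupling matrix. -/
lemma IsDegenerateSystem.exists_isStrictAt (hS : IsDegenerateSystem H B) {y : Torus N}
    {u : Torus N → Fin m → ℝ} (hu : u ∈ subsolutions H B 0) {l k : Fin m}
    (hl : IsStrictAt H B u l y) (hkl : k ≠ l) (hB : B y k l ≠ 0) :
    ∃ u' ∈ subsolutions H B 0, IsStrictAt H B u' k y := by
  obtain ⟨δ, hδ, hstrict⟩ := hl
  have hball : (fun v : E N => y + proj v) '' Metric.ball 0 1 ∈ 𝓝 y :=
    eventually_nhds_of_lift (P := fun z => z ∈ (fun v : E N => y + proj v) '' Metric.ball 0 1)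
      (by filter_upwards [Metric.ball_mem_nhds (0 : E N) one_pos] with v hv using ⟨v, hv, rfl⟩)
  obtain ⟨φ, hφc, hφ0, hφ1, hφy, hφO, hφd⟩ := exists_bump (hstrict.and hball)
  have hφgrad : Continuous (gradient (localLift φ y)) :=
    (InnerProductSpace.toDual ℝ (E N)).symm.continuous.comp (hφd.continuous_fderiv one_ne_zero)
  have hφdz : ∀ z, ContDiff ℝ 1 (localLift φ z) := fun z => by
    obtain ⟨v, rfl⟩ := exists_eq_add_proj y z
    have h1 : localLift φ (y + proj v) = fun w => localLift φ y (v + w) :=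
      funext fun w => localLift_add_proj φ y v w
    rw [h1]
    exact hφd.comp (contDiff_const.add contDiff_id)
  obtain ⟨M, hM⟩ := (isCompact_closedBall (0 : E N) 1).exists_bound_of_continuousOn
    hφgrad.continuousOn
  have hMO : ∀ z ∈ (fun v : E N => y + proj v) '' Metric.ball 0 1,
      ‖gradient (localLift φ z) 0‖ ≤ M := by
    rintro _ ⟨v, hv, rfl⟩
    have h1 : HasGradAt φ (gradient (localLift φ y) v) (y + proj v) :=
      hasGradAt_add_proj_iff.2 ((hφd.differentiable one_ne_zero v).hasGradientAt)
    rw [HasGradientAt.gradient h1]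
    exact hM v (Metric.ball_subset_closedBall hv)
  obtain ⟨c, hc⟩ := (isCompact_range (hS.continuous_mulVec hu.1 l)).bddBelow
  -- Momenta satisfying the strict inequality have `H l ≤ -c`, hence lie in a fixed ball, on which
  -- `H l` is uniformly continuous.
  obtain ⟨R, -, hR⟩ := (hS.hamiltonian l).exists_norm_lt (-c)
  obtain ⟨b, hb⟩ := (isCompact_range (hS.continuous_entry l l)).isBounded.exists_norm_le
  have hunif : ∀ᶠ e in 𝓝 (0 : E N), ∀ a ∈ (Set.univ : Set (Torus N)) ×ˢ
      Metric.closedBall (0 : E N) R, H l a.1 (a.2 + e) < H l a.1 a.2 + δ / 2 := by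
    refine (isCompact_univ.prod (isCompact_closedBall (0 : E N)
      R)).eventually_forall_of_forall_eventually fun a _ => ?_
    have hHc := (hS.hamiltonian l).continuous
    have h1 : Continuous fun r : E N × (Torus N × E N) =>
        H l r.2.1 r.2.2 + δ / 2 - H l r.2.1 (r.2.2 + r.1) :=
      ((hHc.comp continuous_snd).add continuous_const).sub (hHc.comp
        ((continuous_fst.comp continuous_snd).prodMk
          ((continuous_snd.comp continuous_snd).add continuous_fst)))
    have h2 : ∀ᶠ r in 𝓝 ((0 : E N), a),
        0 < H l r.2.1 r.2.2 + δ / 2 - H l r.2.1 (r.2.2 + r.1) :=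
      h1.continuousAt.eventually (lt_mem_nhds (by simpa using hδ))
    filter_upwards [h2] with r hr
    linarith
  obtain ⟨ρ, hρ, hρball⟩ := Metric.eventually_nhds_iff_ball.1 hunif
  -- Adding `ε * φ` to `u_l` spends half of the slack `δ` on the gradient shift and half on the
  -- diagonal entry. Every other equation can only improve, the `k`-th strictly since `B y k l < 0`.
  obtain ⟨ε, hε, hεM, hεb⟩ : ∃ ε > 0, ε * M < ρ ∧ ε * b < δ / 2 := by
    have h1 : ∀ t : ℝ, Tendsto (fun ε : ℝ => ε * t) (𝓝[>] 0) (𝓝 0) := fun t => by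
      have : Continuous fun ε : ℝ => ε * t := by fun_prop
      simpa using (this.tendsto 0).mono_left nhdsWithin_le_nhds
    obtain ⟨ε, h2, h3, h4⟩ := (((h1 M).eventually (gt_mem_nhds hρ)).and
      (((h1 b).eventually (gt_mem_nhds (half_pos hδ))).and self_mem_nhdsWithin)).exists
    exact ⟨ε, h4, h2, h3⟩
  set u' : Torus N → Fin m → ℝ := fun x => u x + Pi.single l (ε * φ x) with hu'
  have hne : ∀ i, i ≠ l → (fun x => u' x i) = fun x => u x i := fun i hi => by
    funext x
    simp [hu', hi]
  have hBu : ∀ z i, (B z *ᵥ u' z) i = (B z *ᵥ u z) i + B z i l * (ε * φ z) := fun z i =>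
    mulVec_add_single _ _ _ _ _
  have hεφ : ∀ z, 0 ≤ ε * φ z := fun z => mul_nonneg hε.le (hφ0 z)
  refine ⟨u', ⟨?_, fun z i p hp => ?_⟩, ?_⟩
  · exact hu.1.add ((continuous_single (A := fun _ : Fin m => ℝ) l).comp
      (continuous_const.mul hφc))
  · rw [hBu]
    rcases eq_or_ne i l with rfl | hi
    · have hfun : (fun x => u' x i) = fun x => u x i + ε * φ x := by
        funext x
        simp [hu']
      rw [hfun] at hp
      have hlift : HasGradientAt (localLift (fun x => ε * φ x) z)
          (ε • gradient (localLift φ z) 0) 0 :=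
        ((hφdz z).differentiable one_ne_zero 0).hasGradientAt.const_mul_real ε
      have hp' := sub_gradient_mem_superdifferential (ψ := fun x => ε * φ x)
        (contDiff_const.mul (hφdz z)).contDiffAt hp
      rw [hlift.gradient] at hp'
      by_cases hz : (∀ p ∈ superdifferential (fun x => u x i) z,
          H i z p + (B z *ᵥ u z) i ≤ -δ) ∧ z ∈ (fun v : E N => y + proj v) '' Metric.ball 0 1
      · have h1 := hz.1 _ hp'
        have h2 : c ≤ (B z *ᵥ u z) i := hc ⟨z, rfl⟩
        have h3 := hR z (p - ε • gradient (localLift φ z) 0) (by linarith)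
        have h4 := hρball (ε • gradient (localLift φ z) 0) (by
          rw [mem_ball_zero_iff, norm_smul, Real.norm_of_nonneg hε.le]
          exact (mul_le_mul_of_nonneg_left (hMO z hz.2) hε.le).trans_lt hεM)
          (z, p - ε • gradient (localLift φ z) 0) ⟨Set.mem_univ _, by simpa using h3.le⟩
        rw [sub_add_cancel] at h4
        have h5 : B z i i * (ε * φ z) ≤ b * ε := by
          have h6 : |B z i i| ≤ b := hb _ ⟨z, rfl⟩
          calc B z i i * (ε * φ z) ≤ |B z i i| * (ε * φ z) :=
                mul_le_mul_of_nonneg_right (le_abs_self _) (hεφ z)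
            _ ≤ b * (ε * 1) := mul_le_mul h6 (mul_le_mul_of_nonneg_left (hφ1 z) hε.le) (hεφ z)
                ((abs_nonneg _).trans h6)
            _ = b * ε := by rw [mul_one]
        simp only at h4 ⊢
        linarith
      · have hφz : φ z = 0 := hφO z hz
        -- Where the bump vanishes it is minimal, so its gradient vanishes and the equation is
        -- unchanged.
        have hmin : IsLocalMin (localLift φ z) 0 := Eventually.of_forall fun v => by
          rw [localLift_zero, hφz]
          exact hφ0 _
        have hgrad : gradient (localLift φ z) 0 = 0 := by
          rw [gradient, hmin.fderiv_eq_zero, map_zero]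
        rw [hgrad, smul_zero, sub_zero] at hp'
        rw [hφz, mul_zero, mul_zero, add_zero]
        exact hu.2 z i p hp'
    · rw [hne i hi] at hp
      have h1 := hu.2 z i p hp
      have h2 := mul_nonpos_of_nonpos_of_nonneg ((hS.coupling z).1 i l hi.symm) (hεφ z)
      linarith
  · have hneg : B y k l * (ε * φ y) < 0 :=
      mul_neg_of_neg_of_pos (lt_of_le_of_ne ((hS.coupling y).1 k l hkl.symm) hB)
        (mul_pos hε hφy)
    refine ⟨-(B y k l * (ε * φ y) / 2), by linarith, ?_⟩
    have hcont : Continuous fun z => B z k l * (ε * φ z) :=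
      (hS.continuous_entry k l).mul (continuous_const.mul hφc)
    filter_upwards [hcont.continuousAt.eventually
      (gt_mem_nhds (show B y k l * (ε * φ y) < B y k l * (ε * φ y) / 2 by linarith))] with z hz p hp
    rw [hne k hkl] at hp
    rw [hBu]
    have h1 := hu.2 z k p hp
    simp only at h1
    linarith

/-- At a point of the Aubry set no equation can be strictly satisfied. -/
lemma IsDegenerateSystem.not_isStrictAt (hS : IsDegenerateSystem H B) {j : Fin m}
    {y : Torus N} (hy : y ∈ aubrySet H B j) {u : Torus N → Fin m → ℝ}
    (hu : u ∈ subsolutions H B 0) (i : Fin m) : ¬ IsStrictAt H B u i y := by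
  intro hi
  -- The indices that no critical subsolution makes strict include `j`. If some index were missing,
  -- a `k` inside would be coupled to an `l` outside, and strictness at `l` would pass to `k`.
  obtain ⟨k, hk, l, hl, hkl⟩ := hS.irreducible y
    {k | ∀ u' ∈ subsolutions H B 0, ¬ IsStrictAt H B u' k y}
    ⟨j, fun u' hu' => hS.not_isStrictAt_base hy hu'⟩
    (fun h => (h ▸ Set.mem_univ i : i ∈ {k | ∀ u' ∈ subsolutions H B 0,
      ¬ IsStrictAt H B u' k y}) u hu hi)
  simp only [Set.mem_ofPred_eq, not_forall, not_not] at hl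
  obtain ⟨u₁, hu₁, hstrict⟩ := hl
  obtain ⟨u₂, hu₂, hstrict₂⟩ := hS.exists_isStrictAt (k := k) hu₁ hstrict
    (fun h => hk u₁ hu₁ (by rwa [h])) hkl
  exact hk u₂ hu₂ hstrict₂

/-! ### Reachable gradients on the Aubry set -/

/-- The set is the slice over `y` of the closure of the graph of the gradient. -/
lemma isClosed_reachableGradients {N : ℕ} (u : Torus N → ℝ) (y : Torus N) :
    IsClosed (reachableGradients u y) := by
  have h : reachableGradients u y =
      (fun p => (y, p)) ⁻¹' closure {a : Torus N × E N | HasGradAt u a.2 a.1} := by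
    ext p
    simp only [Set.mem_preimage, mem_closure_iff_seq_limit]
    constructor
    · rintro ⟨x, q, h1, h2, h3⟩
      exact ⟨fun n => (x n, q n), h1, h2.prodMk_nhds h3⟩
    · rintro ⟨a, h1, h2⟩
      exact ⟨fun n => (a n).1, fun n => (a n).2, h1, (Prod.tendsto_iff _ _).1 h2⟩
  rw [h]
  exact isClosed_closure.preimage (Continuous.prodMk_right y)

/-- Near a point of the Aubry set, the equation is almost satisfied on sets of positive measure. -/
lemma IsDegenerateSystem.exists_almost_equality (hS : IsDegenerateSystem H B) {j : Fin m}
    {y : Torus N} (hy : y ∈ aubrySet H B j) {u : Torus N → Fin m → ℝ}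
    (hu : u ∈ subsolutions H B 0) (i : Fin m) {P : E N → Prop} (hP : ∀ᵐ v : E N, P v)
    {ε : ℝ} (hε : 0 < ε) :
    ∃ v : E N, ‖v‖ < ε ∧ P v ∧
      -ε < H i (y + proj v) (gradient (localLift (fun x => u x i) y) v)
        + (B (y + proj v) *ᵥ u (y + proj v)) i := by
  by_contra! hcon
  obtain ⟨K, hK⟩ := hS.exists_lipschitz
  refine hS.not_isStrictAt hy hu i ⟨ε, hε, eventually_nhds_of_lift ?_⟩
  filter_upwards [Metric.ball_mem_nhds (0 : E N) hε] with v₀ hv₀ p hp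
  obtain ⟨r, hr, hrsub⟩ := Metric.isOpen_iff.1 Metric.isOpen_ball v₀ hv₀
  refine le_of_ae_le (hK u hu i y) (hS.hamiltonian i).continuous
    (fun z => ((hS.hamiltonian i).strictConvex z).convexOn)
    (hS.continuous_mulVec hu.1 i) hr ?_ hp
  filter_upwards [hP] with v hv hvr
  exact hcon v (mem_ball_zero_iff.1 (hrsub hvr)) hv

/-- Finitely many critical subsolutions share a reachable gradient at a point of the Aubry set. -/
lemma IsDegenerateSystem.exists_common_reachable (hS : IsDegenerateSystem H B) {j : Fin m}
    {y : Torus N} (hy : y ∈ aubrySet H B j) (i : Fin m) {ι : Type*} (s : Finset ι)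
    (hs : s.Nonempty) {u : ι → Torus N → Fin m → ℝ} (hu : ∀ k, u k ∈ subsolutions H B 0) :
    ∃ p : E N, ∀ k ∈ s, p ∈ reachableGradients (fun x => u k x i) y ∧
      H i y p + (B y *ᵥ u k y) i = 0 := by
  set w : ι → ℝ := fun _ => (s.card : ℝ)⁻¹ with hw
  have hcard : (0 : ℝ) < s.card := by exact_mod_cast hs.card_pos
  have hwpos : ∀ k ∈ s, 0 < w k := fun _ _ => inv_pos.2 hcard
  have hw1 : ∑ k ∈ s, w k = 1 := by
    simp [hw, mul_inv_cancel₀ hcard.ne']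
  have hav := hS.sum_mul_mem_subsolutions s (fun k hk => (hwpos k hk).le) hw1 fun k _ => hu k
  obtain ⟨K, hK⟩ := hS.exists_lipschitz
  have hae : ∀ᵐ v : E N, ∀ k ∈ s,
      DifferentiableAt ℝ (localLift (fun x => u k x i) y) v := by
    rw [Filter.eventually_all_finset]
    exact fun k _ => (hK _ (hu k) i y).ae_differentiableAt
  -- One sequence of points serves every `u k`, so the gradients there average to the gradient of
  -- the mean.
  choose v hv hd hge using fun n : ℕ => hS.exists_almost_equality hy hav i hae
    (Nat.one_div_pos_of_nat (α := ℝ) (n := n))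
  have hlim := tendsto_one_div_add_atTop_nhds_zero_nat (𝕜 := ℝ)
  have hv0 : Tendsto v atTop (𝓝 0) := squeeze_zero_norm (fun n => (hv n).le) hlim
  set q : ℕ → s → E N := fun n k => gradient (localLift (fun x => u k x i) y) (v n) with hq
  have hqd : ∀ n (k : s), HasGradientAt (localLift (fun x => u k x i) y) (q n k) (v n) :=
    fun n k => (hd n k k.2).hasGradientAt
  have hqK : ∀ n, q n ∈ Set.pi Set.univ fun _ : s => Metric.closedBall (0 : E N) K :=
    fun n k _ => by
      rw [mem_closedBall_zero_iff]
      simp only [hq, gradient, LinearIsometryEquiv.norm_map]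
      exact norm_fderiv_le_of_lipschitz ℝ (hK _ (hu k) i y)
  obtain ⟨p, -, σ, hσ, hp⟩ := (isCompact_univ_pi fun _ : s =>
    isCompact_closedBall (0 : E N) (K : ℝ)).tendsto_subseq hqK
  have hpk : ∀ k : s, Tendsto (fun n => q (σ n) k) atTop (𝓝 (p k)) := tendsto_pi_nhds.1 hp
  have hz := (tendsto_add_proj y).comp (hv0.comp hσ.tendsto_atTop)
  have hHc := (hS.hamiltonian i).continuous
  have hle : ∀ k : s, H i y (p k) + (B y *ᵥ u k y) i ≤ 0 := fun k =>
    le_of_tendsto (((hHc.tendsto (y, p k)).comp (hz.prodMk_nhds (hpk k))).add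
      (((hS.continuous_mulVec (hu k).1 i).tendsto y).comp hz))
      (Eventually.of_forall fun n => hS.le_of_hasGradientAt (hu k) (hqd (σ n) k))
  have hsumlim : Tendsto (fun n => ∑ k : s, w k • q (σ n) k) atTop (𝓝 (∑ k : s, w k • p k)) :=
    tendsto_finsetSum _ fun k _ => (hpk k).const_smul (w k)
  have hav_ge : 0 ≤ H i y (∑ k : s, w k • p k) + ∑ k : s, w k * (B y *ᵥ u k y) i := by
    have h1 : 0 ≤ H i y (∑ k : s, w k • p k) +
        (B y *ᵥ fun l => ∑ k ∈ s, w k * u k y l) i := by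
      refine le_of_tendsto_of_tendsto (neg_zero (G := ℝ) ▸ (hlim.comp hσ.tendsto_atTop).neg)
        (((hHc.tendsto (y, _)).comp (hz.prodMk_nhds hsumlim)).add
        (((hS.continuous_mulVec hav.1 i).tendsto y).comp hz)) (Eventually.of_forall fun n => ?_)
      have h2 := hge (σ n)
      have h3 := hasGradientAt_sum_mul s w fun k hk => (hd (σ n) k hk).hasGradientAt
      rw [HasGradientAt.gradient (f := localLift (fun x => ∑ k ∈ s, w k * u k x i) y) h3,
        ← Finset.sum_coe_sort s] at h2
      exact h2.le
    rwa [mulVec_sum_mul, ← Finset.sum_coe_sort s] at h1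
  have hw1' : ∑ k : s, w k = 1 := by rw [Finset.sum_coe_sort s w, hw1]
  have hconvex := (hS.hamiltonian i).strictConvex y
  have hsum_le : ∑ k : s, w k * (H i y (p k) + (B y *ᵥ u k y) i) ≤ 0 :=
    Finset.sum_nonpos fun k _ => mul_nonpos_of_nonneg_of_nonpos (hwpos k k.2).le (hle k)
  have hsum_eq : ∑ k : s, w k * (H i y (p k) + (B y *ᵥ u k y) i) =
      ∑ k : s, w k • H i y (p k) + ∑ k : s, w k * (B y *ᵥ u k y) i := by
    simp only [mul_add, Finset.sum_add_distrib, smul_eq_mul]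
  have hjensen := hconvex.convexOn.map_sum_le (t := Finset.univ) (w := fun k : s => w k)
    (fun k _ => (hwpos k k.2).le) hw1' (p := p) (fun _ _ => Set.mem_univ _)
  -- `hav_ge` and `hsum_le` give the reverse of Jensen's inequality; with positive weights, strict
  -- convexity makes all the `p k` equal.
  have hall := hconvex.eq_of_le_map_sum (t := Finset.univ) (w := fun k : s => w k)
    (fun k _ => hwpos k k.2) hw1' (p := p) (fun _ _ => Set.mem_univ _) (by linarith)
  have hzero : ∑ k : s, w k * (H i y (p k) + (B y *ᵥ u k y) i) = 0 := by linarith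
  obtain ⟨k₀, hk₀⟩ := hs
  refine ⟨p ⟨k₀, hk₀⟩, fun k hk => ?_⟩
  rw [hall (Finset.mem_univ ⟨k₀, hk₀⟩) (Finset.mem_univ ⟨k, hk⟩)]
  refine ⟨⟨fun n => y + proj (v (σ n)), fun n => q (σ n) ⟨k, hk⟩,
    fun n => hasGradAt_add_proj_iff.2 (hqd (σ n) ⟨k, hk⟩), hz, hpk ⟨k, hk⟩⟩, ?_⟩
  have h1 := (Finset.sum_eq_zero_iff_of_nonpos fun (k : s) _ =>
    mul_nonpos_of_nonneg_of_nonpos (hwpos k k.2).le (hle k)).1 hzero ⟨k, hk⟩ (Finset.mem_univ _)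
  exact (mul_eq_zero.1 h1).resolve_left (hwpos k hk).ne'

end System

end WeaklyCoupledHJ

open WeaklyCoupledHJ in
theorem mainTheorem8 {N m : ℕ}
    (H : Fin m → Torus N → E N → ℝ)
    (B : Torus N → Matrix (Fin m) (Fin m) ℝ)
    (hH : ∀ i, IsStrictlyConvexHamiltonian (H i))
    (hBcont : ∀ i j, Continuous fun x => B x i j)
    (hBcoupling : ∀ x, IsCouplingMatrix (B x))
    (hBirreducible : ∀ x, IsIrreducibleMatrix (B x))
    (hBdegenerate : ∀ x, IsDegenerateMatrix (B x))
    (hcritical : IsCriticalValue H B 0)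
    (j : Fin m) (y : Torus N) (hy : y ∈ aubrySet H B j) :
    ∀ i : Fin m, ∃ p : E N, ∀ u ∈ subsolutions H B 0,
      p ∈ reachableGradients (fun x => u x i) y ∧ H i y p + (B y *ᵥ u y) i = 0 := by
  classical
  intro i
  have hS : IsDegenerateSystem H B := ⟨hH, hBcont, hBcoupling, hBirreducible, hBdegenerate⟩
  -- The Mañé column at `y` is itself a critical subsolution. It supplies the compact set for the
  -- intersection argument and keeps each finite family nonempty.
  set u₀ : subsolutions H B 0 := ⟨_, hy.1⟩
  set T : subsolutions H B 0 → Set (E N) := fun u =>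
    {p | p ∈ reachableGradients (fun x => u.1 x i) y ∧ H i y p + (B y *ᵥ u.1 y) i = 0} with hT
  have hclosed : ∀ u, IsClosed (T u) := fun u =>
    (isClosed_reachableGradients _ y).inter (isClosed_eq
      (((hH i).continuous.comp (Continuous.prodMk_right y)).add continuous_const) continuous_const)
  obtain ⟨R, -, hR⟩ := (hH i).exists_norm_lt (-(B y *ᵥ u₀.1 y) i)
  have hcompact : IsCompact (T u₀) :=
    (isCompact_closedBall (0 : E N) R).of_isClosed_subset (hclosed u₀) fun p hp => by
      rw [mem_closedBall_zero_iff]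
      exact (hR y p (by linarith [hp.2])).le
  obtain ⟨p, -, hp⟩ := hcompact.inter_iInter_nonempty T hclosed fun s => by
    obtain ⟨p, hp⟩ := hS.exists_common_reachable hy i (insert u₀ s) (Finset.insert_nonempty _ _)
      (u := fun u : subsolutions H B 0 => u.1) fun u => u.2
    refine ⟨p, hp u₀ (Finset.mem_insert_self _ _), ?_⟩
    simp only [Set.mem_iInter]
    exact fun u hu => hp u (Finset.mem_insert_of_mem hu)
  exact ⟨p, fun u hu => Set.mem_iInter.1 hp ⟨u, hu⟩⟩
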